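/- Let $\mathbb D$ be the open unit disc, $dA=\frac{dx\,dy}{\pi}$, and let $H^2$ be the Hardy space of holomorphic functions $f(z)=\sum_{n\ge0}a_nz^n$ on $\mathbb D$ with $\|f\|_{H^2}^2=\sum_n|a_n|^2<\infty$. Let $\mu$ be a positive Borel measure on $\mathbb D$ with $\int_{\mathbb D}(1-|w|^2)\,d\mu(w)<\infty$, and let $\omega$ be the pure superharmonic weight with Riesz measure $\mu$, that is, the Green potential $$\omega(z)=\int_{\mathbb D}\log\left|\frac{1-\overline w z}{z-w}\right|d\mu(w),\qquad z\in\mathbb D .$$ Let $\mathcal D_\omega$ be the space of all $f\in H^2$ with $\int_{\mathbb D}|f'|^2\omega\,dA<\infty$, with the norm given by $$\|f\|_{\mathcal D_\omega}^2=\|f\|_{H^2}^2+\int_{\mathbb D}|f'(z)|^2\omega(z)\,dA(z).$$ Then $\mathcal D_\omega$ has a reproducing kernel $K^\omega$, and there are universal constants $0<c\le C<\infty$ (independent of $\mu$ and $z$) such that for all $z\in\mathbb D\setminus\{0\}$ $$c\,\Bigl(1+\int_0^{|z|}\frac{dr}{(1-r)V_\mu(rz/|z|)+(1-r)^2}\Bigr)\le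 K^\omega(z,z)\le C\,\Bigl(1+\int_0^{|z|}\frac{dr}{(1-r)V_\mu(rz/|z|)+(1-r)^2}\Bigr),$$ where $$V_\mu(z)=\int_{\mathbb D}\frac{(1-|z|^2)(1-|w|^2)}{|1-z\overline w|^2}\,d\mu(w),\qquad z\in\mathbb D.$$ -/

import Mathlib

open MeasureTheory
open scoped ENNReal ComplexConjugate

namespace SuperharmonicDirichlet

noncomputable section

/-- The open unit disc. -/
def disc : Set ℂ := Metric.ball (0 : ℂ) 1

/-- The normalized area measure `dA = dx dy / π` on the unit disc. -/
def areaMeasure : Measure ℂ := (ENNReal.ofReal Real.pi)⁻¹ • volume.restrict disc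

/-- The Green kernel `log |(1 - conj w * z) / (z - w)|` of the unit disc, with value `+∞` on the
diagonal. It is nonnegative for `z, w` in the disc. -/
def greenKernel (z w : ℂ) : ℝ≥0∞ :=
  open Classical in
  if z = w then ⊤ else ENNReal.ofReal (Real.log ‖(1 - conj w * z) / (z - w)‖)

/-- The Green potential `G_μ` of a positive Borel measure `μ` on the disc. A measure on the disc is
given as a measure on `ℂ` of which only the restriction to the disc is ever used. -/
def greenPotential (μ : Measure ℂ) (z : ℂ) : ℝ≥0∞ :=
  ∫⁻ w in disc, greenKernel z w ∂μ

/-- `ω` is the pure superharmonic weight on the disc with Riesz measure `μ`: it is the Green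
potential of `μ`, where `∫ (1 - |w|²) dμ(w) < ∞`. -/
structure IsPureSuperharmonicWeight (ω : ℂ → ℝ≥0∞) (μ : Measure ℂ) : Prop where
  riesz_finite : ∫⁻ w in disc, ENNReal.ofReal (1 - ‖w‖ ^ 2) ∂μ < ⊤
  eq_green : ∀ z ∈ disc, ω z = greenPotential μ z

/-- The `n`-th Taylor coefficient of `f` at the origin. -/
def taylorCoeff (f : ℂ → ℂ) (n : ℕ) : ℂ := iteratedDeriv n f 0 / (n.factorial : ℂ)

/-- Membership in the Hardy space `H²`: `f` is holomorphic on the disc, with square summable Taylor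
coefficients. Values of `f` outside the disc are irrelevant. -/
def MemHardy (f : ℂ → ℂ) : Prop :=
  DifferentiableOn ℂ f disc ∧ Summable fun n => ‖taylorCoeff f n‖ ^ 2

/-- The inner product of `H²`. -/
def hardyInner (f g : ℂ → ℂ) : ℂ := ∑' n, taylorCoeff f n * conj (taylorCoeff g n)

/-- The weighted Dirichlet integral `∫ |f'|² ω dA`. -/
def dirichletIntegral (ω : ℂ → ℝ≥0∞) (f : ℂ → ℂ) : ℝ≥0∞ :=
  ∫⁻ z, ‖deriv f z‖ₑ ^ 2 * ω z ∂areaMeasure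

/-- Membership in the weighted Dirichlet space `D_ω`. -/
def MemDirichlet (ω : ℂ → ℝ≥0∞) (f : ℂ → ℂ) : Prop :=
  MemHardy f ∧ dirichletIntegral ω f < ⊤

/-- The inner product of `D_ω`, whose norm is `‖f‖² = ‖f‖²_{H²} + ∫ |f'|² ω dA`. -/
def dirichletInner (ω : ℂ → ℝ≥0∞) (f g : ℂ → ℂ) : ℂ :=
  hardyInner f g + ∫ z, deriv f z * conj (deriv g z) * ((ω z).toReal : ℂ) ∂areaMeasure

/-- `K` is the reproducing kernel of `D_ω`: for every `z` in the disc, `K(·, z)` belongs to `D_ω`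
and `f(z) = ⟨f, K(·, z)⟩` for every `f` in `D_ω`. -/
def IsReproducingKernel (ω : ℂ → ℝ≥0∞) (K : ℂ → ℂ → ℂ) : Prop :=
  ∀ z ∈ disc, MemDirichlet ω (fun ζ => K ζ z) ∧
    ∀ f : ℂ → ℂ, MemDirichlet ω f → f z = dirichletInner ω f (fun ζ => K ζ z)

/-- `V_μ(z) = ∫ (1 - |z|²)(1 - |w|²) / |1 - z conj w|² dμ(w)`. -/
def V (μ : Measure ℂ) (z : ℂ) : ℝ :=
  ∫ w in disc, (1 - ‖z‖ ^ 2) * (1 - ‖w‖ ^ 2) / ‖1 - z * conj w‖ ^ 2 ∂μ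

/-- `1 + ∫_0^{|z|} dr / ((1 - r) V_μ(r z / |z|) + (1 - r)²)`. -/
def kernelSize (μ : Measure ℂ) (z : ℂ) : ℝ :=
  1 + ∫ r in (0 : ℝ)..‖z‖, 1 / ((1 - r) * V μ ((r : ℂ) * z / (‖z‖ : ℂ)) + (1 - r) ^ 2)

end

end SuperharmonicDirichlet

/-!
Write `e = z / |z|`, `ψ(r) = (1 - r) V_μ(r e) + (1 - r)²` and `S = ∫_0^{|z|} dr / ψ(r)`, so that
`kernelSize μ z = 1 + S`.

Upper bound. Since `V_μ ≤ 2 ω` on the disc, `∫ |f'|² V_μ dA` is controlled by the Dirichlet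
integral. As `V_μ` satisfies a Harnack inequality and `|f'|²` is subharmonic, averaging over
hyperbolic discs centred on the radius through `z` gives `∫_0^1 |f'(r e)|² ψ(r) dr ≲ ‖f‖²`; the term
`(1 - r)²` of `ψ` comes from adding a unit mass at `0` to `μ`, whose contribution is bounded by the
Hardy norm. Cauchy–Schwarz then gives `|f z - f 0|² ≲ S ‖f‖²`, which is applied to `f = K(·, z)`.

Lower bound. The test function is the superposition `∫_0^{|z|} c(x) / (1 - x conj e ζ) dx` of Szegő
kernels with `c(x) = (1 - x) / ψ(x)`. Hilbert's inequality bounds its Hardy norm, and after a change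
of variables by the Möbius involution at `w` also its energy against the Green kernel with pole `w`.
Integrating against `dμ(w)` yields a squared norm at most `16 S`, whereas the value at `z` is at
least `S / 2`.
-/

namespace SuperharmonicDirichlet

open Set
open scoped Real

noncomputable section
lemma enorm_sq_eq_ofReal {E : Type*} [SeminormedAddCommGroup E] (x : E) :
    ‖x‖ₑ ^ 2 = ENNReal.ofReal (‖x‖ ^ 2) := by
  rw [ENNReal.ofReal_pow (norm_nonneg _), ofReal_norm]

lemma enorm_natCast_add_one_sq (n : ℕ) :
    ‖(n + 1 : ℂ)‖ₑ ^ 2 = ENNReal.ofReal ((n + 1) ^ 2) := by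
  have : ‖(n + 1 : ℂ)‖ = n + 1 := by exact_mod_cast Complex.norm_natCast (n + 1)
  rw [enorm_sq_eq_ofReal, this]

lemma hasSum_norm_sq_of_orthonormal {ι 𝕜 E : Type*} [RCLike 𝕜] [NormedAddCommGroup E]
    [InnerProductSpace 𝕜 E] {e : ι → E} (he : Orthonormal 𝕜 e) {a : ι → 𝕜} {x : E}
    (hx : HasSum (fun i => a i • e i) x) : HasSum (fun i => ‖a i‖ ^ 2) (‖x‖ ^ 2) := by
  refine ((continuous_norm.pow 2).tendsto x |>.comp hx).congr fun s => ?_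
  rw [Function.comp_apply, Pi.pow_apply, ← RCLike.ofReal_inj (K := 𝕜), RCLike.ofReal_pow,
    ← inner_self_eq_norm_sq_to_K, he.inner_sum]
  simp [RCLike.conj_mul]

lemma eLpNorm_two_sq {α ε : Type*} [MeasurableSpace α] [ENorm ε] (f : α → ε) (m : Measure α) :
    eLpNorm f 2 m ^ 2 = ∫⁻ x, ‖f x‖ₑ ^ 2 ∂m := by
  simpa using eLpNorm_nnreal_pow_eq_lintegral (f := f) (μ := m) (two_ne_zero (α := NNReal))

/-- The sum of `∑ aₙ e^{inθ}` exists in `C(ℝ / 2πℤ)`, hence in `L²`, where the characters are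
orthonormal. -/
lemma lintegral_enorm_sq_tsum_exp {a : ℕ → ℂ} (ha : Summable fun n => ‖a n‖) :
    ∫⁻ θ in Ioo (-π) π, ‖∑' n, a n * Complex.exp (n * θ * Complex.I)‖ₑ ^ 2 =
      ENNReal.ofReal (2 * π) * ∑' n, ‖a n‖ₑ ^ 2 := by
  have : Fact (0 < 2 * π) := ⟨Real.two_pi_pos⟩
  let toLp := ContinuousMap.toLp (E := ℂ) 2 (AddCircle.haarAddCircle (T := 2 * π)) ℂ
  obtain ⟨F, hF⟩ : Summable fun n : ℕ => a n • fourier (T := 2 * π) n :=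
    .of_norm (by simpa [norm_smul, fourier_norm] using ha)
  have parseval : HasSum (fun n => ‖a n‖ ^ 2) (‖toLp F‖ ^ 2) :=
    hasSum_norm_sq_of_orthonormal (orthonormal_fourier.comp _ Nat.cast_injective)
      (by simpa using hF.mapL toLp)
  have series (θ : ℝ) : F θ = ∑' n, a n * Complex.exp (n * θ * Complex.I) := by
    rw [← (ContinuousMap.hasSum_apply hF (θ : AddCircle (2 * π))).tsum_eq]
    refine tsum_congr fun n => ?_
    rw [ContinuousMap.smul_apply, fourier_coe_apply, smul_eq_mul]
    congr 2
    have : (π : ℂ) ≠ 0 := Complex.ofReal_ne_zero.2 Real.pi_ne_zero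
    push_cast
    field_simp
  have norm_sq : ‖toLp F‖ₑ ^ 2 = ∫⁻ t, ‖F t‖ₑ ^ 2 ∂AddCircle.haarAddCircle := by
    rw [Lp.enorm_def, eLpNorm_two_sq]
    refine lintegral_congr_ae ?_
    filter_upwards [ContinuousMap.coeFn_toLp (𝕜 := ℂ) (p := 2) AddCircle.haarAddCircle F]
      with t ht
    rw [ht]
  have haar := AddCircle.lintegral_preimage (2 * π) (-π) fun t => ‖F t‖ₑ ^ 2
  simp only [series] at haar
  rw [AddCircle.volume_eq_smul_haarAddCircle, lintegral_smul_measure, smul_eq_mul, ← norm_sq,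
    enorm_sq_eq_ofReal, ← parseval.tsum_eq,
    ENNReal.ofReal_tsum_of_nonneg (fun n => by positivity) parseval.summable,
    show -π + 2 * π = π by ring, ← restrict_Ioo_eq_restrict_Ioc] at haar
  simpa only [enorm_sq_eq_ofReal] using haar

lemma measurableSet_disc : MeasurableSet disc := Metric.isOpen_ball.measurableSet

lemma isOpen_disc : IsOpen disc := Metric.isOpen_ball

lemma mem_disc {z : ℂ} : z ∈ disc ↔ ‖z‖ < 1 := by simp [disc]

lemma one_sub_normSq_pos {w : ℂ} (hw : w ∈ disc) : 0 < 1 - ‖w‖ ^ 2 := by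
  nlinarith [mem_disc.1 hw, norm_nonneg w]

instance sFinite_areaMeasure : SFinite areaMeasure := by unfold areaMeasure; infer_instance

lemma ae_mem_disc : ∀ᵐ z ∂areaMeasure, z ∈ disc :=
  Measure.ae_smul_measure (ae_restrict_mem measurableSet_disc) _

lemma lintegral_areaMeasure (F : ℂ → ℝ≥0∞) :
    ∫⁻ z, F z ∂areaMeasure = (ENNReal.ofReal π)⁻¹ * ∫⁻ z in disc, F z := by
  rw [areaMeasure, lintegral_smul_measure, smul_eq_mul]

lemma norm_polarCoord_symm {r : ℝ} (hr : 0 < r) (θ : ℝ) :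
    ‖Complex.polarCoord.symm (r, θ)‖ = r := by
  simp [abs_of_pos hr]

lemma polarCoord_symm_eq_mul_exp (r θ : ℝ) :
    Complex.polarCoord.symm (r, θ) = r * Complex.exp (θ * Complex.I) := by
  simp [Complex.polarCoord_symm_apply, Complex.exp_mul_I]

lemma lintegral_areaMeasure_eq_polar {F : ℂ → ℝ≥0∞} (hF : Measurable F) :
    ∫⁻ z, F z ∂areaMeasure = (ENNReal.ofReal π)⁻¹ * ∫⁻ r in Ioo (0 : ℝ) 1,
      ENNReal.ofReal r * ∫⁻ θ in Ioo (-π) π, F (Complex.polarCoord.symm (r, θ)) := by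
  have hpolar : Measurable fun p : ℝ × ℝ => Complex.polarCoord.symm p := by
    simp only [Complex.polarCoord_symm_apply]; fun_prop
  have hFdisc : Measurable (disc.indicator F) := hF.indicator measurableSet_disc
  rw [lintegral_areaMeasure, ← lintegral_indicator measurableSet_disc,
    ← Complex.lintegral_comp_polarCoord_symm, polarCoord_target, Measure.volume_eq_prod,
    ← Measure.prod_restrict, lintegral_prod _ (by fun_prop),
    ← inter_eq_left.2 (Ioo_subset_Ioi_self : Ioo (0 : ℝ) 1 ⊆ Ioi 0),
    ← Measure.restrict_restrict measurableSet_Ioo, ← lintegral_indicator measurableSet_Ioo]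
  congr 1
  refine setLIntegral_congr_fun measurableSet_Ioi fun r (hr : 0 < r) => ?_
  have mem_iff (θ : ℝ) : Complex.polarCoord.symm (r, θ) ∈ disc ↔ r < 1 := by
    rw [mem_disc, norm_polarCoord_symm hr]
  by_cases h1 : r < 1
  · simp only [indicator, mem_iff, mem_Ioo, hr, h1, if_true, and_self, smul_eq_mul,
      lintegral_const_mul' _ _ ENNReal.ofReal_ne_top]
  · simp only [indicator, mem_iff, mem_Ioo, h1, if_false, and_false, smul_zero, lintegral_zero]

lemma lintegral_circle_enorm_sq {h : ℂ → ℂ} {a : ℕ → ℂ}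
    (hh : ∀ z ∈ disc, HasSum (fun n => a n * z ^ n) (h z)) {r : ℝ} (hr : r ∈ Ioo (0 : ℝ) 1) :
    ∫⁻ θ in Ioo (-π) π, ‖h (Complex.polarCoord.symm (r, θ))‖ₑ ^ 2 =
      ENNReal.ofReal (2 * π) * ∑' n, ‖a n‖ₑ ^ 2 * ENNReal.ofReal (r ^ (2 * n)) := by
  have series (θ : ℝ) : h (Complex.polarCoord.symm (r, θ)) =
      ∑' n, (a n * r ^ n) * Complex.exp (n * θ * Complex.I) := by
    rw [← (hh _ (by rw [mem_disc, norm_polarCoord_symm hr.1]; exact hr.2)).tsum_eq]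
    refine tsum_congr fun n => ?_
    rw [polarCoord_symm_eq_mul_exp, mul_pow, ← Complex.exp_nat_mul, ← mul_assoc, ← mul_assoc]
  have summable : Summable fun n => ‖a n * (r : ℂ) ^ n‖ :=
    (hh r (by simpa [mem_disc, abs_of_pos hr.1] using hr.2)).summable.norm
  simp only [series, lintegral_enorm_sq_tsum_exp summable]
  congr! 3 with n
  simp only [enorm_sq_eq_ofReal]
  rw [← ENNReal.ofReal_mul (by positivity), norm_mul, norm_pow, Complex.norm_real, mul_pow,
    Real.norm_of_nonneg hr.1.le, ← pow_mul, mul_comm n]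

lemma measurable_indicator_of_continuousOn {h : ℂ → ℂ} {s : Set ℂ} (hc : ContinuousOn h s)
    (hs : MeasurableSet s) : Measurable (s.indicator h) := by
  classical
  rw [← piecewise_eq_indicator]
  exact hc.measurable_piecewise continuousOn_const hs

lemma lintegral_enorm_sq_mul_radial {h : ℂ → ℂ} {a : ℕ → ℂ} (hc : ContinuousOn h disc)
    (hh : ∀ z ∈ disc, HasSum (fun n => a n * z ^ n) (h z)) {ρ : ℝ → ℝ≥0∞} (hρ : Measurable ρ) :
    ∫⁻ z, ‖h z‖ₑ ^ 2 * ρ ‖z‖ ∂areaMeasure =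
      ∑' n, ‖a n‖ₑ ^ 2 * (2 * ∫⁻ r in Ioo (0 : ℝ) 1, ENNReal.ofReal (r ^ (2 * n + 1)) * ρ r) := by
  have hmeas := measurable_indicator_of_continuousOn hc measurableSet_disc
  have indicator_congr : ∫⁻ z, ‖h z‖ₑ ^ 2 * ρ ‖z‖ ∂areaMeasure =
      ∫⁻ z, ‖disc.indicator h z‖ₑ ^ 2 * ρ ‖z‖ ∂areaMeasure := by
    refine lintegral_congr_ae ?_
    filter_upwards [ae_mem_disc] with z hz
    rw [indicator_of_mem hz]
  have circle : ∀ r ∈ Ioo (0 : ℝ) 1, ENNReal.ofReal r * ∫⁻ θ in Ioo (-π) π,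
      ‖disc.indicator h (Complex.polarCoord.symm (r, θ))‖ₑ ^ 2 *
        ρ ‖Complex.polarCoord.symm (r, θ)‖ =
      ENNReal.ofReal (2 * π) *
        ∑' n, ‖a n‖ₑ ^ 2 * (ENNReal.ofReal (r ^ (2 * n + 1)) * ρ r) := by
    intro r hr
    have hind : ∀ z ∈ disc, HasSum (fun n => a n * z ^ n) (disc.indicator h z) :=
      fun z hz => by rw [indicator_of_mem hz]; exact hh z hz
    simp only [norm_polarCoord_symm hr.1]
    rw [lintegral_mul_const'' _ (by simp only [Complex.polarCoord_symm_apply]; fun_prop),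
      lintegral_circle_enorm_sq hind hr, mul_assoc, mul_left_comm, ← ENNReal.tsum_mul_right,
      ← ENNReal.tsum_mul_left]
    congr! 3 with n
    rw [pow_succ r, ENNReal.ofReal_mul (pow_nonneg hr.1.le _)]
    ring
  rw [indicator_congr, lintegral_areaMeasure_eq_polar (by fun_prop),
    setLIntegral_congr_fun measurableSet_Ioo circle,
    lintegral_const_mul' _ _ ENNReal.ofReal_ne_top, lintegral_tsum (fun n => by fun_prop),
    ENNReal.ofReal_mul zero_le_two, ENNReal.ofReal_ofNat, ← mul_assoc, mul_left_comm,
    ENNReal.inv_mul_cancel (by simp [Real.pi_pos]) ENNReal.ofReal_ne_top, mul_one,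
    ← ENNReal.tsum_mul_left]
  refine tsum_congr fun n => ?_
  rw [lintegral_const_mul' _ _ (ENNReal.pow_ne_top enorm_ne_top), mul_left_comm]
lemma hasSum_taylorCoeff {f : ℂ → ℂ} (hf : DifferentiableOn ℂ f disc) {z : ℂ} (hz : z ∈ disc) :
    HasSum (fun n => taylorCoeff f n * z ^ n) (f z) := by
  refine (Complex.hasSum_taylorSeries_on_ball hf hz).congr_fun fun n => ?_
  simp only [taylorCoeff, smul_eq_mul, sub_zero]
  ring

lemma hasFPowerSeriesOnBall_ofScalars {f : ℂ → ℂ} {a : ℕ → ℂ}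
    (h : ∀ z ∈ disc, HasSum (fun n => a n * z ^ n) (f z)) :
    HasFPowerSeriesOnBall f (.ofScalars ℂ a) 0 1 where
  r_le := by
    refine ENNReal.le_of_forall_nnreal_lt fun r hr => ?_
    have hr1 : (r : ℝ) < 1 := by exact_mod_cast hr
    refine FormalMultilinearSeries.le_radius_of_tendsto _ (l := 0) ?_
    have := (h (r : ℝ) (by simpa [mem_disc] using hr1)).summable.norm.tendsto_atTop_zero
    simpa [FormalMultilinearSeries.ofScalars_norm] using this
  r_pos := one_pos
  hasSum {y} hy := by
    have hy : y ∈ disc := by simpa [mem_disc, ← ofReal_norm] using hy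
    simpa [FormalMultilinearSeries.ofScalars_apply_eq, mul_comm] using h y hy

lemma differentiableOn_of_hasSum {f : ℂ → ℂ} {a : ℕ → ℂ}
    (h : ∀ z ∈ disc, HasSum (fun n => a n * z ^ n) (f z)) : DifferentiableOn ℂ f disc :=
  (hasFPowerSeriesOnBall_ofScalars h).differentiableOn.mono fun z hz => by
    simpa [← ofReal_norm] using mem_disc.1 hz

lemma taylorCoeff_eq_of_hasSum {f : ℂ → ℂ} {a : ℕ → ℂ}
    (h : ∀ z ∈ disc, HasSum (fun n => a n * z ^ n) (f z)) (n : ℕ) : taylorCoeff f n = a n := by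
  have h1 := (hasFPowerSeriesOnBall_ofScalars h).hasFPowerSeriesAt
  have h2 := h1.eq_formalMultilinearSeries h1.analyticAt.hasFPowerSeriesAt
  have h3 := congrArg (fun p : FormalMultilinearSeries ℂ ℂ ℂ => p n fun _ => 1) h2
  simpa [FormalMultilinearSeries.ofScalars_apply_eq, taylorCoeff] using h3.symm

lemma taylorCoeff_zero (f : ℂ → ℂ) : taylorCoeff f 0 = f 0 := by simp [taylorCoeff]

lemma taylorCoeff_deriv (f : ℂ → ℂ) (n : ℕ) :
    taylorCoeff (deriv f) n = (n + 1) * taylorCoeff f (n + 1) := by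
  have : (n.factorial : ℂ) ≠ 0 := by exact_mod_cast n.factorial_ne_zero
  have : (n : ℂ) + 1 ≠ 0 := by exact_mod_cast n.succ_ne_zero
  rw [taylorCoeff, taylorCoeff, iteratedDeriv_succ', Nat.factorial_succ]
  push_cast
  field_simp

lemma differentiableOn_deriv {f : ℂ → ℂ} (hf : DifferentiableOn ℂ f disc) :
    DifferentiableOn ℂ (deriv f) disc := hf.deriv isOpen_disc

lemma hasSum_deriv {f : ℂ → ℂ} (hf : DifferentiableOn ℂ f disc) {z : ℂ} (hz : z ∈ disc) :
    HasSum (fun n : ℕ => (n + 1) * taylorCoeff f (n + 1) * z ^ n) (deriv f z) := by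
  simpa only [taylorCoeff_deriv] using hasSum_taylorCoeff (differentiableOn_deriv hf) hz

lemma hasSum_deriv_of_hasSum {f : ℂ → ℂ} {a : ℕ → ℂ}
    (h : ∀ z ∈ disc, HasSum (fun n => a n * z ^ n) (f z)) {z : ℂ} (hz : z ∈ disc) :
    HasSum (fun n : ℕ => (n + 1) * a (n + 1) * z ^ n) (deriv f z) := by
  simpa only [taylorCoeff_eq_of_hasSum h] using hasSum_deriv (differentiableOn_of_hasSum h) hz

lemma hasSum_succ_mul_geometric {x : ℂ} (hx : ‖x‖ < 1) :
    HasSum (fun n : ℕ => (n + 1) * x ^ n) (1 / (1 - x) ^ 2) := by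
  simpa using hasSum_choose_mul_geometric_of_norm_lt_one 1 hx

lemma lintegral_deriv_of_nonneg {G G' : ℝ → ℝ} {a b : ℝ} (hab : a ≤ b)
    (hc : ContinuousOn G (Icc a b)) (hd : ∀ x ∈ Ioo a b, HasDerivAt G (G' x) x)
    (hn : ∀ x ∈ Ioo a b, 0 ≤ G' x) :
    ∫⁻ x in Ioo a b, ENNReal.ofReal (G' x) = ENNReal.ofReal (G b - G a) := by
  have hint := intervalIntegral.integrableOn_deriv_of_nonneg hc hd hn
  rw [← ofReal_integral_eq_lintegral_ofReal (hint.mono_set Ioo_subset_Ioc_self)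
    ((ae_restrict_iff' measurableSet_Ioo).2 (ae_of_all _ hn)),
    ← integral_Ioc_eq_integral_Ioo, ← intervalIntegral.integral_of_le hab,
    intervalIntegral.integral_eq_sub_of_hasDerivAt_of_le hab hc hd
      ((intervalIntegrable_iff_integrableOn_Ioc_of_le hab).2 hint)]

lemma lintegral_pow_mul_one_sub_sq (n : ℕ) :
    ∫⁻ r in Ioo (0 : ℝ) 1, ENNReal.ofReal (r ^ (2 * n + 1)) * ENNReal.ofReal (1 - r ^ 2) =
      ENNReal.ofReal (1 / (2 * ((n + 1) * (n + 2)))) := by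
  let G (r : ℝ) : ℝ := r ^ (2 * n + 2) / (2 * n + 2) - r ^ (2 * n + 4) / (2 * n + 4)
  have hderiv (r : ℝ) : HasDerivAt G (r ^ (2 * n + 1) * (1 - r ^ 2)) r := by
    refine (((hasDerivAt_pow (2 * n + 2) r).div_const (2 * n + 2 : ℝ)).sub
      ((hasDerivAt_pow (2 * n + 4) r).div_const (2 * n + 4 : ℝ))).congr_deriv ?_
    simp only [Nat.add_one_sub_one]
    push_cast
    field_simp
    ring
  have hnonneg : ∀ r ∈ Ioo (0 : ℝ) 1, 0 ≤ r ^ (2 * n + 1) * (1 - r ^ 2) := fun r hr =>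
    mul_nonneg (pow_nonneg hr.1.le _) (by nlinarith [hr.1, hr.2])
  rw [setLIntegral_congr_fun measurableSet_Ioo fun r hr =>
      (ENNReal.ofReal_mul (pow_nonneg hr.1.le _)).symm,
    lintegral_deriv_of_nonneg zero_le_one (fun r _ => (hderiv r).continuousAt.continuousWithinAt)
      (fun r _ => hderiv r) hnonneg]
  congr 1
  simp only [G, one_pow, ne_eq, Nat.add_eq_zero_iff, OfNat.ofNat_ne_zero, and_false,
    not_false_eq_true, zero_pow, zero_div, sub_zero]
  field_simp
  ring

lemma lintegral_pow_mul_log_inv (n : ℕ) :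
    ∫⁻ r in Ioo (0 : ℝ) 1, ENNReal.ofReal (r ^ (2 * n + 1)) * ENNReal.ofReal (Real.log r⁻¹) =
      ENNReal.ofReal (1 / (4 * (n + 1) ^ 2)) := by
  set k : ℝ := 2 * n + 2 with hk
  let G (r : ℝ) : ℝ := r ^ (2 * n + 2) / k ^ 2 - r ^ (2 * n + 1) * (r * Real.log r) / k
  have hcont : Continuous G := by
    have := Real.continuous_mul_log
    fun_prop
  have hderiv : ∀ r ∈ Ioo (0 : ℝ) 1, HasDerivAt G (r ^ (2 * n + 1) * Real.log r⁻¹) r := by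
    intro r hr
    have hr0 : r ≠ 0 := hr.1.ne'
    have hk0 : k ≠ 0 := by positivity
    refine (((hasDerivAt_pow (2 * n + 2) r).div_const (k ^ 2)).sub
      (((hasDerivAt_pow (2 * n + 1) r).mul
        ((hasDerivAt_id r).mul (Real.hasDerivAt_log hr0))).div_const k)).congr_deriv ?_
    simp only [Nat.add_one_sub_one, Real.log_inv, Pi.mul_apply, id]
    push_cast
    rw [← hk, show (2 * n + 1 : ℝ) = k - 1 by rw [hk]; ring]
    field_simp
    ring
  rw [setLIntegral_congr_fun measurableSet_Ioo fun r hr =>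
      (ENNReal.ofReal_mul (pow_nonneg hr.1.le _)).symm,
    lintegral_deriv_of_nonneg zero_le_one hcont.continuousOn hderiv fun r hr =>
      mul_nonneg (pow_nonneg hr.1.le _) (Real.log_nonneg ((one_le_inv₀ hr.1).2 hr.2.le))]
  congr 1
  simp only [G, one_pow, Real.log_one, mul_zero, zero_div, sub_zero, ne_eq, Nat.add_eq_zero_iff,
    OfNat.ofNat_ne_zero, and_false, not_false_eq_true, zero_pow, zero_mul, hk]
  field_simp
  ring

lemma lintegral_deriv_sq_mul_one_sub_sq_le {f : ℂ → ℂ} (hf : DifferentiableOn ℂ f disc) :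
    ∫⁻ z, ‖deriv f z‖ₑ ^ 2 * ENNReal.ofReal (1 - ‖z‖ ^ 2) ∂areaMeasure ≤
      ∑' n, ‖taylorCoeff f n‖ₑ ^ 2 := by
  rw [lintegral_enorm_sq_mul_radial (ρ := fun r => ENNReal.ofReal (1 - r ^ 2))
      (differentiableOn_deriv hf).continuousOn (fun z hz => hasSum_deriv hf hz) (by fun_prop),
    tsum_eq_zero_add' (f := fun n => ‖taylorCoeff f n‖ₑ ^ 2) ENNReal.summable]
  refine le_trans (ENNReal.tsum_le_tsum fun n => ?_) le_add_self
  rw [lintegral_pow_mul_one_sub_sq, enorm_mul, mul_pow, mul_right_comm, enorm_natCast_add_one_sq]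
  refine mul_le_of_le_one_left' ?_
  rw [← ENNReal.ofReal_ofNat, ← ENNReal.ofReal_mul zero_le_two,
    ← ENNReal.ofReal_mul (by positivity), ENNReal.ofReal_le_one]
  calc ((n : ℝ) + 1) ^ 2 * (2 * (1 / (2 * ((n + 1) * (n + 2))))) = (n + 1) / (n + 2) := by
        field_simp
    _ ≤ 1 := by rw [div_le_one (by positivity)]; linarith

/-- The Green kernel with pole at the origin, as a function of `|z|`. -/
def greenRadial (r : ℝ) : ℝ≥0∞ :=
  if r = 0 then ⊤ else ENNReal.ofReal (Real.log r⁻¹)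

lemma measurable_greenRadial : Measurable greenRadial :=
  Measurable.ite (measurableSet_singleton 0) measurable_const (by fun_prop)

lemma lintegral_pow_mul_greenRadial (n : ℕ) :
    ∫⁻ r in Ioo (0 : ℝ) 1, ENNReal.ofReal (r ^ (2 * n + 1)) * greenRadial r =
      ENNReal.ofReal (1 / (4 * (n + 1) ^ 2)) := by
  rw [← lintegral_pow_mul_log_inv]
  refine setLIntegral_congr_fun measurableSet_Ioo fun r hr => ?_
  rw [greenRadial, if_neg hr.1.ne']

lemma lintegral_enorm_sq_mul_greenRadial {h : ℂ → ℂ} {b : ℕ → ℂ} (hc : ContinuousOn h disc)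
    (hh : ∀ z ∈ disc, HasSum (fun n : ℕ => (n + 1) * b n * z ^ n) (h z)) :
    ∫⁻ z, ‖h z‖ₑ ^ 2 * greenRadial ‖z‖ ∂areaMeasure = 2⁻¹ * ∑' n, ‖b n‖ₑ ^ 2 := by
  rw [lintegral_enorm_sq_mul_radial hc hh measurable_greenRadial, ← ENNReal.tsum_mul_left]
  refine tsum_congr fun n => ?_
  rw [lintegral_pow_mul_greenRadial, enorm_mul, mul_pow, mul_right_comm,
    enorm_natCast_add_one_sq]
  congr 1
  rw [← ENNReal.ofReal_ofNat, ← ENNReal.ofReal_mul zero_le_two,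
    ← ENNReal.ofReal_mul (by positivity), ← ENNReal.ofReal_inv_of_pos two_pos]
  congr 1
  field_simp
  norm_num

lemma one_sub_conj_mul_ne_zero {w z : ℂ} (hw : w ∈ disc) (hz : z ∈ disc) :
    1 - conj w * z ≠ 0 := by
  have norm_lt_one : ‖conj w * z‖ < 1 := by
    rw [norm_mul, RCLike.norm_conj]
    exact mul_lt_one_of_nonneg_of_lt_one_left (norm_nonneg w) (mem_disc.1 hw) (mem_disc.1 hz).le
  exact sub_ne_zero.2 fun h => by simp [← h] at norm_lt_one

lemma normSq_one_sub_conj_mul (w z : ℂ) :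
    ‖1 - conj w * z‖ ^ 2 - ‖w - z‖ ^ 2 = (1 - ‖z‖ ^ 2) * (1 - ‖w‖ ^ 2) := by
  simp only [← Complex.normSq_eq_norm_sq, Complex.normSq_apply, Complex.sub_re, Complex.sub_im,
    Complex.mul_re, Complex.mul_im, Complex.conj_re, Complex.conj_im, Complex.one_re,
    Complex.one_im]
  ring

lemma one_sub_conj_mul_self (w : ℂ) : 1 - conj w * w = ((1 - ‖w‖ ^ 2 : ℝ) : ℂ) := by
  rw [Complex.conj_mul']
  norm_cast

/-- The involutive automorphism `z ↦ (w - z) / (1 - conj w z)` of the disc, which exchanges `0`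
and `w`. -/
def moebius (w z : ℂ) : ℂ := (w - z) / (1 - conj w * z)

section Moebius

variable {w z : ℂ} (hw : w ∈ disc) (hz : z ∈ disc)
include hw hz

lemma one_sub_normSq_moebius :
    1 - ‖moebius w z‖ ^ 2 = (1 - ‖z‖ ^ 2) * (1 - ‖w‖ ^ 2) / ‖1 - conj w * z‖ ^ 2 := by
  have denom_ne_zero : ‖1 - conj w * z‖ ^ 2 ≠ 0 := by simpa using one_sub_conj_mul_ne_zero hw hz
  rw [moebius, norm_div, div_pow, ← normSq_one_sub_conj_mul, sub_div, div_self denom_ne_zero]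

lemma moebius_mem_disc : moebius w z ∈ disc := by
  have hw' := one_sub_normSq_pos hw
  have hz' := one_sub_normSq_pos hz
  have denom_pos : 0 < ‖1 - conj w * z‖ := norm_pos_iff.2 (one_sub_conj_mul_ne_zero hw hz)
  have : 0 < 1 - ‖moebius w z‖ ^ 2 := by rw [one_sub_normSq_moebius hw hz]; positivity
  rw [mem_disc]
  nlinarith [norm_nonneg (moebius w z)]

lemma one_sub_conj_mul_moebius :
    1 - conj w * moebius w z = (1 - conj w * w) / (1 - conj w * z) := by
  have denom_ne_zero := one_sub_conj_mul_ne_zero hw hz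
  rw [moebius]
  field_simp
  ring

lemma moebius_sub_self :
    moebius w z - w = -z * ((1 - conj w * w) / (1 - conj w * z)) := by
  rw [moebius, div_sub' (one_sub_conj_mul_ne_zero hw hz)]
  ring

lemma moebius_moebius : moebius w (moebius w z) = z := by
  rw [moebius, one_sub_conj_mul_moebius hw hz, ← neg_sub, moebius_sub_self hw hz, neg_mul, neg_neg,
    mul_div_cancel_right₀ _
      (div_ne_zero (one_sub_conj_mul_ne_zero hw hw) (one_sub_conj_mul_ne_zero hw hz))]

lemma hasDerivAt_moebius :
    HasDerivAt (moebius w) (-(1 - conj w * w) / (1 - conj w * z) ^ 2) z := by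
  have h := ((hasDerivAt_id z).const_sub w).div
    (((hasDerivAt_id z).const_mul (conj w)).const_sub 1) (one_sub_conj_mul_ne_zero hw hz)
  refine h.congr_deriv ?_
  simp only [id]
  ring

lemma greenKernel_moebius : greenKernel (moebius w z) w = greenRadial ‖z‖ := by
  have ratio_ne_zero : (1 - conj w * w) / (1 - conj w * z) ≠ 0 :=
    div_ne_zero (one_sub_conj_mul_ne_zero hw hw) (one_sub_conj_mul_ne_zero hw hz)
  have pole_iff : moebius w z = w ↔ ‖z‖ = 0 := by
    rw [← sub_eq_zero, moebius_sub_self hw hz, mul_eq_zero_iff_right ratio_ne_zero, neg_eq_zero,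
      norm_eq_zero]
  rw [greenKernel, greenRadial, moebius_sub_self hw hz, one_sub_conj_mul_moebius hw hz,
    div_mul_cancel_right₀ ratio_ne_zero, norm_inv, norm_neg]
  simp only [pole_iff]

lemma greenKernel_eq_greenRadial_moebius : greenKernel z w = greenRadial ‖moebius w z‖ := by
  rw [← greenKernel_moebius hw (moebius_mem_disc hw hz), moebius_moebius hw hz]

end Moebius

lemma image_moebius_disc {w : ℂ} (hw : w ∈ disc) : moebius w '' disc = disc := by
  ext z
  exact ⟨fun ⟨y, hy, h⟩ => h ▸ moebius_mem_disc hw hy,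
    fun hz => ⟨moebius w z, moebius_mem_disc hw hz, moebius_moebius hw hz⟩⟩

lemma injOn_moebius {w : ℂ} (hw : w ∈ disc) : InjOn (moebius w) disc := fun x hx y hy h => by
  rw [← moebius_moebius hw hx, h, moebius_moebius hw hy]

lemma det_restrictScalars_toSpanSingleton (a : ℂ) :
    ((ContinuousLinearMap.toSpanSingleton ℂ a).restrictScalars ℝ).det = ‖a‖ ^ 2 := by
  simp [ContinuousLinearMap.det, LinearMap.det_restrictScalars, Algebra.norm_complex_eq,
    Complex.normSq_eq_norm_sq]

lemma lintegral_image_eq_lintegral_enorm_deriv_sq_mul {φ φ' : ℂ → ℂ} {s : Set ℂ}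
    (hs : MeasurableSet s) (hφ : ∀ z ∈ s, HasDerivAt φ (φ' z) z) (hi : InjOn φ s) (g : ℂ → ℝ≥0∞) :
    ∫⁻ z in φ '' s, g z = ∫⁻ z in s, ‖φ' z‖ₑ ^ 2 * g (φ z) := by
  rw [lintegral_image_eq_lintegral_abs_det_fderiv_mul volume hs
    (fun z hz => ((hφ z hz).hasFDerivAt.restrictScalars ℝ).hasFDerivWithinAt) hi]
  refine lintegral_congr fun z => ?_
  rw [det_restrictScalars_toSpanSingleton, abs_of_nonneg (by positivity), enorm_sq_eq_ofReal]

lemma lintegral_enorm_sq_mul_greenKernel {w : ℂ} (hw : w ∈ disc) {h : ℂ → ℂ} {b : ℕ → ℂ}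
    (hc : ContinuousOn h disc)
    (hh : ∀ z ∈ disc, HasSum (fun n : ℕ => (n + 1) * b n * z ^ n)
      (h (moebius w z) * (-(1 - conj w * w) / (1 - conj w * z) ^ 2))) :
    ∫⁻ z, ‖h z‖ₑ ^ 2 * greenKernel z w ∂areaMeasure = 2⁻¹ * ∑' n, ‖b n‖ₑ ^ 2 := by
  have continuousOn_moebius : ContinuousOn (moebius w) disc := fun z hz =>
    (hasDerivAt_moebius hw hz).continuousAt.continuousWithinAt
  have continuousOn_transport : ContinuousOn
      (fun z => h (moebius w z) * (-(1 - conj w * w) / (1 - conj w * z) ^ 2)) disc :=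
    (hc.comp continuousOn_moebius fun z hz => moebius_mem_disc hw hz).mul
      (continuousOn_const.div (by fun_prop) fun z hz =>
        pow_ne_zero _ (one_sub_conj_mul_ne_zero hw hz))
  rw [← lintegral_enorm_sq_mul_greenRadial continuousOn_transport hh, lintegral_areaMeasure,
    lintegral_areaMeasure]
  congr 1
  conv_lhs => rw [← image_moebius_disc hw]
  rw [lintegral_image_eq_lintegral_enorm_deriv_sq_mul measurableSet_disc
    (fun z hz => hasDerivAt_moebius hw hz) (injOn_moebius hw)]
  refine setLIntegral_congr_fun measurableSet_disc fun z hz => ?_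
  rw [greenKernel_moebius hw hz, enorm_mul, mul_pow]
  ring

lemma lintegral_greenKernel_eq {w : ℂ} (hw : w ∈ disc) :
    ∫⁻ z, greenKernel z w ∂areaMeasure = 2⁻¹ * ENNReal.ofReal (1 - ‖w‖ ^ 2) := by
  have one_sub_pos := one_sub_normSq_pos hw
  have sq_lt_one : ‖w‖ ^ 2 < 1 := by linarith
  have expansion : ∀ z ∈ disc, HasSum
      (fun n : ℕ => (n + 1) * (-(1 - conj w * w) * conj w ^ n) * z ^ n)
      (1 * (-(1 - conj w * w) / (1 - conj w * z) ^ 2)) := by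
    intro z hz
    have norm_lt_one : ‖conj w * z‖ < 1 := by
      rw [norm_mul, RCLike.norm_conj]
      exact mul_lt_one_of_nonneg_of_lt_one_left (norm_nonneg w) (mem_disc.1 hw) (mem_disc.1 hz).le
    have := (hasSum_succ_mul_geometric norm_lt_one).mul_left (-(1 - conj w * w))
    rw [one_mul, ← mul_one_div]
    exact this.congr_fun fun n => by rw [mul_pow]; ring
  have coeff_sq (n : ℕ) : ‖-(1 - conj w * w) * conj w ^ n‖ₑ ^ 2 =
      ENNReal.ofReal ((1 - ‖w‖ ^ 2) ^ 2 * (‖w‖ ^ 2) ^ n) := by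
    rw [enorm_sq_eq_ofReal, norm_mul, norm_neg, one_sub_conj_mul_self, Complex.norm_real,
      Real.norm_of_nonneg one_sub_pos.le, norm_pow, RCLike.norm_conj]
    congr 1
    ring
  have h := lintegral_enorm_sq_mul_greenKernel hw continuousOn_const expansion
  simp only [enorm_one, one_pow, one_mul, coeff_sq] at h
  rw [h, ← ENNReal.ofReal_tsum_of_nonneg (fun n => by positivity)
    ((summable_geometric_of_lt_one (by positivity) sq_lt_one).mul_left _), tsum_mul_left,
    tsum_geometric_of_lt_one (by positivity) sq_lt_one, sq (1 - ‖w‖ ^ 2), mul_assoc,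
    mul_inv_cancel₀ one_sub_pos.ne', mul_one]

lemma one_sub_sq_le_two_mul_log_inv {x : ℝ} (hx : 0 < x) : 1 - x ^ 2 ≤ 2 * Real.log x⁻¹ := by
  have := Real.log_le_sub_one_of_pos (pow_pos hx 2)
  rw [Real.log_pow] at this
  rw [Real.log_inv]
  push_cast at this
  linarith

/-- The integrand of `V`, so called because `V μ` is a Berezin-type transform of `μ`. -/
def berezinKernel (z w : ℂ) : ℝ :=
  (1 - ‖z‖ ^ 2) * (1 - ‖w‖ ^ 2) / ‖1 - z * conj w‖ ^ 2

lemma berezinKernel_nonneg {z w : ℂ} (hz : z ∈ disc) (hw : w ∈ disc) :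
    0 ≤ berezinKernel z w :=
  div_nonneg (mul_nonneg (one_sub_normSq_pos hz).le (one_sub_normSq_pos hw).le) (by positivity)

lemma ofReal_berezinKernel_le {z w : ℂ} (hz : z ∈ disc) (hw : w ∈ disc) :
    ENNReal.ofReal (berezinKernel z w) ≤ 2 * greenKernel z w := by
  have eq_moebius : berezinKernel z w = 1 - ‖moebius w z‖ ^ 2 := by
    rw [one_sub_normSq_moebius hw hz, berezinKernel, mul_comm z]
  rw [greenKernel_eq_greenRadial_moebius hw hz, greenRadial, eq_moebius]
  split_ifs with h0
  · simp
  · rw [← ENNReal.ofReal_ofNat, ← ENNReal.ofReal_mul zero_le_two]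
    exact ENNReal.ofReal_le_ofReal
      (one_sub_sq_le_two_mul_log_inv ((norm_nonneg _).lt_of_ne' h0))

lemma measurable_greenKernel : Measurable fun p : ℂ × ℂ => greenKernel p.1 p.2 := by
  unfold greenKernel
  exact Measurable.ite (measurableSet_eq_fun measurable_fst measurable_snd) measurable_const
    (by fun_prop)

lemma measurable_berezinKernel : Measurable fun p : ℂ × ℂ => berezinKernel p.1 p.2 := by
  unfold berezinKernel
  fun_prop

/-- `V μ` as a Lebesgue integral with values in `[0, ∞]`. -/
def lintegralV (μ : Measure ℂ) (z : ℂ) : ℝ≥0∞ :=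
  ∫⁻ w in disc, ENNReal.ofReal (berezinKernel z w) ∂μ

lemma measurable_lintegralV (μ : Measure ℂ) [SFinite (μ.restrict disc)] :
    Measurable (lintegralV μ) :=
  measurable_berezinKernel.ennreal_ofReal.lintegral_prod_right'

lemma V_eq_toReal {μ : Measure ℂ} {z : ℂ} (hz : z ∈ disc) : V μ z = (lintegralV μ z).toReal :=
  integral_eq_lintegral_of_nonneg_ae
    ((ae_restrict_iff' measurableSet_disc).2 (ae_of_all μ fun _ hw => berezinKernel_nonneg hz hw))
    (measurable_berezinKernel.comp measurable_prodMk_left).aestronglyMeasurable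

lemma lintegralV_le_two_mul_greenPotential (μ : Measure ℂ) {z : ℂ} (hz : z ∈ disc) :
    lintegralV μ z ≤ 2 * greenPotential μ z := by
  rw [greenPotential, ← lintegral_const_mul' _ _ ENNReal.ofNat_ne_top]
  exact setLIntegral_mono' measurableSet_disc fun w hw => ofReal_berezinKernel_le hz hw

lemma one_sub_norm_le_norm_one_sub_mul_conj {z w : ℂ} (hw : ‖w‖ ≤ 1) :
    1 - ‖z‖ ≤ ‖1 - z * conj w‖ := by
  have h := norm_sub_norm_le (1 : ℂ) (z * conj w)
  rw [norm_one, norm_mul, RCLike.norm_conj] at h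
  nlinarith [norm_nonneg z]

section RieszFinite

variable {μ : Measure ℂ} (hμ : ∫⁻ w in disc, ENNReal.ofReal (1 - ‖w‖ ^ 2) ∂μ < ⊤)
include hμ

lemma sFinite_restrict_disc : SFinite (μ.restrict disc) := by
  have : IsFiniteMeasure ((μ.restrict disc).withDensity fun w => ENNReal.ofReal (1 - ‖w‖ ^ 2)) :=
    isFiniteMeasure_withDensity hμ.ne
  rw [← withDensity_inv_same (μ := μ.restrict disc)
    (f := fun w : ℂ => ENNReal.ofReal (1 - ‖w‖ ^ 2)) (by fun_prop)
    ((ae_restrict_iff' measurableSet_disc).2 (ae_of_all μ fun w hw =>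
      (ENNReal.ofReal_pos.2 (one_sub_normSq_pos hw)).ne'))
    (ae_of_all _ fun _ => ENNReal.ofReal_ne_top)]
  infer_instance

lemma lintegralV_lt_top {z : ℂ} (hz : z ∈ disc) : lintegralV μ z < ⊤ := by
  have hz1 := mem_disc.1 hz
  have hz2 := one_sub_normSq_pos hz
  calc lintegralV μ z
      ≤ ∫⁻ w in disc, ENNReal.ofReal ((1 - ‖z‖ ^ 2) / (1 - ‖z‖) ^ 2) *
          ENNReal.ofReal (1 - ‖w‖ ^ 2) ∂μ := by
        refine setLIntegral_mono' measurableSet_disc fun w hw => ?_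
        have hw2 := one_sub_normSq_pos hw
        rw [← ENNReal.ofReal_mul (by positivity), berezinKernel, div_mul_eq_mul_div]
        have : 0 < 1 - ‖z‖ := by linarith
        gcongr
        exact one_sub_norm_le_norm_one_sub_mul_conj (mem_disc.1 hw).le
    _ < ⊤ := by
        rw [lintegral_const_mul' _ _ ENNReal.ofReal_ne_top]
        exact ENNReal.mul_lt_top ENNReal.ofReal_lt_top hμ

end RieszFinite

section Harnack

variable {c z : ℂ} (hc : c ∈ disc) (hz : ‖z - c‖ ≤ (1 - ‖c‖) / 2)
include hc hz

lemma mem_disc_of_norm_sub_le : z ∈ disc := by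
  have := norm_sub_norm_le z c
  have := mem_disc.1 hc
  rw [mem_disc]
  linarith

lemma berezinKernel_le_nine_mul {w : ℂ} (hw : w ∈ disc) :
    berezinKernel c w ≤ 9 * berezinKernel z w := by
  have hc1 := mem_disc.1 hc
  have hz1 := mem_disc_of_norm_sub_le hc hz
  have hz2 := one_sub_normSq_pos hz1
  have hw1 := one_sub_normSq_pos hw
  have norm_le : ‖z‖ ≤ ‖c‖ + (1 - ‖c‖) / 2 := by linarith [norm_sub_norm_le z c]
  have one_sub_sq_le : 1 - ‖c‖ ^ 2 ≤ 4 * (1 - ‖z‖ ^ 2) := by nlinarith [norm_nonneg z]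
  have le_denom_c := one_sub_norm_le_norm_one_sub_mul_conj (z := c) (mem_disc.1 hw).le
  have le_denom_z := one_sub_norm_le_norm_one_sub_mul_conj (z := z) (mem_disc.1 hw).le
  have denom_c_pos : 0 < ‖1 - c * conj w‖ := by linarith
  have denom_z_pos : 0 < ‖1 - z * conj w‖ := by linarith [mem_disc.1 hz1]
  have denom_le : ‖1 - z * conj w‖ ≤ 3 / 2 * ‖1 - c * conj w‖ := by
    have shift_le : ‖(z - c) * conj w‖ ≤ (1 - ‖c‖) / 2 := by
      rw [norm_mul, RCLike.norm_conj]
      exact (mul_le_of_le_one_right (norm_nonneg _) (mem_disc.1 hw).le).trans hz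
    rw [show 1 - z * conj w = (1 - c * conj w) - (z - c) * conj w by ring]
    linarith [norm_sub_le (1 - c * conj w) ((z - c) * conj w)]
  have denom_sq_le : ‖1 - z * conj w‖ ^ 2 ≤ 9 / 4 * ‖1 - c * conj w‖ ^ 2 := by nlinarith
  rw [berezinKernel, berezinKernel, mul_div_assoc',
    div_le_div_iff₀ (by positivity) (by positivity)]
  calc (1 - ‖c‖ ^ 2) * (1 - ‖w‖ ^ 2) * ‖1 - z * conj w‖ ^ 2
      ≤ (4 * (1 - ‖z‖ ^ 2)) * (1 - ‖w‖ ^ 2) * (9 / 4 * ‖1 - c * conj w‖ ^ 2) := by gcongr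
    _ = 9 * ((1 - ‖z‖ ^ 2) * (1 - ‖w‖ ^ 2)) * ‖1 - c * conj w‖ ^ 2 := by ring

lemma lintegralV_le_nine_mul (μ : Measure ℂ) : lintegralV μ c ≤ 9 * lintegralV μ z := by
  rw [lintegralV, lintegralV, ← lintegral_const_mul' _ _ ENNReal.ofNat_ne_top]
  refine setLIntegral_mono' measurableSet_disc fun w hw => ?_
  rw [← ENNReal.ofReal_ofNat, ← ENNReal.ofReal_mul (by norm_num)]
  exact ENNReal.ofReal_le_ofReal (berezinKernel_le_nine_mul hc hz hw)

end Harnack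

lemma aestronglyMeasurable_areaMeasure {h : ℂ → ℂ} (hc : ContinuousOn h disc) :
    AEStronglyMeasurable h areaMeasure :=
  (hc.aestronglyMeasurable measurableSet_disc).smul_measure _

lemma image_affine_disc (c : ℂ) {R : ℝ} (hR : 0 < R) :
    (fun ζ : ℂ => c + R * ζ) '' disc = Metric.ball c R := by
  open scoped Pointwise in
  rw [← affinity_unitBall hR c, ← image_smul, ← image_vadd, image_image]
  rfl

lemma enorm_sq_zero_le_lintegral {h : ℂ → ℂ} (hh : DifferentiableOn ℂ h disc) :
    ‖h 0‖ₑ ^ 2 ≤ ∫⁻ z, ‖h z‖ₑ ^ 2 ∂areaMeasure := by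
  have expansion := lintegral_enorm_sq_mul_radial (ρ := fun _ => 1) hh.continuousOn
    (fun z hz => hasSum_taylorCoeff hh hz) measurable_const
  have mass : ∫⁻ r in Ioo (0 : ℝ) 1, ENNReal.ofReal (r ^ (2 * 0 + 1)) = 2⁻¹ := by
    have := lintegral_deriv_of_nonneg (G := fun r => r ^ 2 / 2) (G' := fun r => r ^ (2 * 0 + 1))
      zero_le_one (by fun_prop)
      (fun r _ => ((hasDerivAt_pow 2 r).div_const 2).congr_deriv (by norm_num))
      (fun r hr => by have := hr.1; positivity)
    rw [this, ← ENNReal.ofReal_ofNat, ← ENNReal.ofReal_inv_of_pos two_pos]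
    norm_num
  simp only [mul_one] at expansion
  rw [expansion]
  refine le_trans (le_of_eq ?_) (ENNReal.le_tsum 0)
  rw [mass, ENNReal.mul_inv_cancel two_ne_zero ENNReal.ofNat_ne_top, mul_one, taylorCoeff_zero]

lemma enorm_sq_mul_le_lintegral_ball {h : ℂ → ℂ} {c : ℂ} {R : ℝ} (hR : 0 < R)
    (hh : DifferentiableOn ℂ h (Metric.ball c R)) :
    ENNReal.ofReal (R ^ 2) * ‖h c‖ₑ ^ 2 ≤
      (ENNReal.ofReal π)⁻¹ * ∫⁻ z in Metric.ball c R, ‖h z‖ₑ ^ 2 := by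
  have hR' : (R : ℂ) ≠ 0 := by exact_mod_cast hR.ne'
  have image_eq := image_affine_disc c hR
  have injOn : InjOn (fun ζ : ℂ => c + R * ζ) disc := fun x _ y _ hxy => by simpa [hR'] using hxy
  have hasDerivAt (ζ : ℂ) : HasDerivAt (fun ζ : ℂ => c + R * ζ) R ζ := by
    simpa using ((hasDerivAt_id ζ).const_mul (R : ℂ)).const_add c
  have submean := enorm_sq_zero_le_lintegral (h := fun ζ => h (c + R * ζ))
    (hh.comp (by fun_prop) fun ζ hζ => image_eq ▸ mem_image_of_mem _ hζ)
  rw [lintegral_areaMeasure] at submean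
  have jacobian : ‖(R : ℂ)‖ₑ ^ 2 = ENNReal.ofReal (R ^ 2) := by
    rw [enorm_sq_eq_ofReal, Complex.norm_real, Real.norm_eq_abs, sq_abs]
  rw [← image_eq, lintegral_image_eq_lintegral_enorm_deriv_sq_mul measurableSet_disc
    (fun ζ _ => hasDerivAt ζ) injOn, lintegral_const_mul' _ _ (ENNReal.pow_ne_top enorm_ne_top),
    jacobian, mul_left_comm]
  gcongr
  simpa using submean

lemma norm_ofReal_mul {e : ℂ} (he : ‖e‖ = 1) {r : ℝ} (hr : 0 ≤ r) : ‖(r : ℂ) * e‖ = r := by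
  rw [norm_mul, he, Complex.norm_real, Real.norm_of_nonneg hr, mul_one]

lemma ofReal_mul_mem_disc {e : ℂ} (he : ‖e‖ = 1) {r : ℝ} (hr : 0 ≤ r) (hr1 : r < 1) :
    (r : ℂ) * e ∈ disc := by
  rwa [mem_disc, norm_ofReal_mul he hr]

/-- The fraction `1 / (1 - r)` on the hyperbolic disc `|z - c| < (1 - |c|) / 2` about the point
`c = r e` of the radius through `e`. -/
def radialTent (e : ℂ) : ℝ × ℂ → ℝ≥0∞ :=
  {p | ‖p.2 - p.1 * e‖ < (1 - p.1) / 2}.indicator fun p => ENNReal.ofReal (1 / (1 - p.1))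

lemma measurable_radialTent (e : ℂ) : Measurable (radialTent e) :=
  Measurable.indicator (by fun_prop) (measurableSet_lt (by fun_prop) (by fun_prop))

lemma lintegral_radialTent_le {e : ℂ} (he : ‖e‖ = 1) {z : ℂ} (hz : z ∈ disc) :
    ∫⁻ r in Ioo (0 : ℝ) 1, radialTent e (r, z) ≤ 2 := by
  set d := 1 - ‖z‖
  have hd0 : 0 < d := sub_pos.2 (mem_disc.1 hz)
  calc ∫⁻ r in Ioo (0 : ℝ) 1, radialTent e (r, z)
      ≤ ∫⁻ r in Ioo (0 : ℝ) 1, (Ioo (1 - 2 * d) (1 - 2 / 3 * d)).indicator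
          (fun _ => ENNReal.ofReal (3 / 2 / d)) r := by
        refine setLIntegral_mono' measurableSet_Ioo fun r hr => ?_
        rw [radialTent]
        refine indicator_apply_le' (fun h => ?_) fun _ => zero_le
        rw [mem_ofPred_eq] at h
        have h1 := norm_sub_norm_le z (r * e)
        have h2 := norm_sub_norm_le (r * e) z
        rw [norm_sub_rev, norm_ofReal_mul he hr.1.le] at h2
        rw [norm_ofReal_mul he hr.1.le] at h1
        have r_mem : r ∈ Ioo (1 - 2 * d) (1 - 2 / 3 * d) := ⟨by linarith, by linarith⟩
        rw [indicator_of_mem r_mem]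
        refine ENNReal.ofReal_le_ofReal ?_
        rw [div_le_div_iff₀ (sub_pos.2 hr.2) hd0]
        linarith [r_mem.2]
    _ ≤ ∫⁻ r : ℝ, (Ioo (1 - 2 * d) (1 - 2 / 3 * d)).indicator
          (fun _ => ENNReal.ofReal (3 / 2 / d)) r := setLIntegral_le_lintegral _ _
    _ = 2 := by
        rw [lintegral_indicator measurableSet_Ioo, setLIntegral_const, Real.volume_Ioo,
          ← ENNReal.ofReal_mul (by positivity)]
        have : 3 / 2 / d * (1 - 2 / 3 * d - (1 - 2 * d)) = 2 := by
          field_simp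
          ring
        rw [this, ENNReal.ofReal_ofNat]

section Doubling

variable {h : ℂ → ℂ} (hh : DifferentiableOn ℂ h disc) {W : ℂ → ℝ≥0∞} {K : ℝ≥0∞}
  (hdbl : ∀ c ∈ disc, ∀ z, ‖z - c‖ ≤ (1 - ‖c‖) / 2 → W c ≤ K * W z)
include hh hdbl

lemma enorm_sq_mul_weight_le_lintegral_ball {c : ℂ} (hc : c ∈ disc) :
    ENNReal.ofReal (((1 - ‖c‖) / 2) ^ 2) * (‖h c‖ₑ ^ 2 * W c) ≤
      (ENNReal.ofReal π)⁻¹ *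
        ∫⁻ z in Metric.ball c ((1 - ‖c‖) / 2), ‖h z‖ₑ ^ 2 * (K * W z) := by
  set R := (1 - ‖c‖) / 2
  have hR : 0 < R := half_pos (sub_pos.2 (mem_disc.1 hc))
  have hball : DifferentiableOn ℂ h (Metric.ball c R) := hh.mono fun z hz =>
    mem_disc_of_norm_sub_le hc (mem_ball_iff_norm.1 hz).le
  calc ENNReal.ofReal (R ^ 2) * (‖h c‖ₑ ^ 2 * W c)
      ≤ (ENNReal.ofReal π)⁻¹ * (∫⁻ z in Metric.ball c R, ‖h z‖ₑ ^ 2) * W c := by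
        rw [← mul_assoc]
        exact mul_le_mul_left (enorm_sq_mul_le_lintegral_ball hR hball) _
    _ = (ENNReal.ofReal π)⁻¹ * ∫⁻ z in Metric.ball c R, ‖h z‖ₑ ^ 2 * W c := by
        rw [mul_assoc, lintegral_mul_const'']
        exact (hball.continuousOn.aestronglyMeasurable measurableSet_ball).enorm.pow_const 2
    _ ≤ (ENNReal.ofReal π)⁻¹ * ∫⁻ z in Metric.ball c R, ‖h z‖ₑ ^ 2 * (K * W z) := by
        gcongr _ * ?_
        refine setLIntegral_mono' measurableSet_ball fun z hz => ?_
        gcongr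
        exact hdbl c hc z (mem_ball_iff_norm.1 hz).le

lemma enorm_sq_mul_le_lintegral_radialTent_mul {e : ℂ} (he : ‖e‖ = 1) {r : ℝ}
    (hr : r ∈ Ioo (0 : ℝ) 1) :
    ‖h (r * e)‖ₑ ^ 2 * (ENNReal.ofReal (1 - r) * W (r * e)) ≤
      4 * ∫⁻ z, radialTent e (r, z) * (‖h z‖ₑ ^ 2 * (K * W z)) ∂areaMeasure := by
  have hr1 : 0 < 1 - r := sub_pos.2 hr.2
  have hc := ofReal_mul_mem_disc he hr.1.le hr.2
  have submean := enorm_sq_mul_weight_le_lintegral_ball hh hdbl hc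
  rw [norm_ofReal_mul he hr.1.le] at submean
  have ball_subset : Metric.ball ((r : ℂ) * e) ((1 - r) / 2) ⊆ disc := fun z hz =>
    mem_disc_of_norm_sub_le hc (by
      rw [norm_ofReal_mul he hr.1.le]; exact (mem_ball_iff_norm.1 hz).le)
  have split_factor : ENNReal.ofReal (1 - r) =
      4 * ENNReal.ofReal (1 / (1 - r)) * ENNReal.ofReal (((1 - r) / 2) ^ 2) := by
    rw [← ENNReal.ofReal_ofNat, ← ENNReal.ofReal_mul (by norm_num),
      ← ENNReal.ofReal_mul (by positivity)]
    congr 1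
    field_simp
    norm_num
  calc ‖h (r * e)‖ₑ ^ 2 * (ENNReal.ofReal (1 - r) * W (r * e))
      = 4 * ENNReal.ofReal (1 / (1 - r)) *
          (ENNReal.ofReal (((1 - r) / 2) ^ 2) * (‖h (r * e)‖ₑ ^ 2 * W (r * e))) := by
        rw [split_factor]; ring
    _ ≤ 4 * ENNReal.ofReal (1 / (1 - r)) * ((ENNReal.ofReal π)⁻¹ *
          ∫⁻ z in Metric.ball ((r : ℂ) * e) ((1 - r) / 2), ‖h z‖ₑ ^ 2 * (K * W z)) := by
        gcongr
    _ = 4 * ((ENNReal.ofReal π)⁻¹ * ∫⁻ z in Metric.ball ((r : ℂ) * e) ((1 - r) / 2),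
          radialTent e (r, z) * (‖h z‖ₑ ^ 2 * (K * W z))) := by
        rw [mul_assoc, mul_left_comm (ENNReal.ofReal (1 / (1 - r))),
          ← lintegral_const_mul' _ _ ENNReal.ofReal_ne_top]
        congr 2
        refine setLIntegral_congr_fun measurableSet_ball fun z hz => ?_
        have tent_mem : (r, z) ∈ {p : ℝ × ℂ | ‖p.2 - p.1 * e‖ < (1 - p.1) / 2} :=
          mem_ball_iff_norm.1 hz
        rw [radialTent, indicator_of_mem tent_mem]
    _ ≤ 4 * ∫⁻ z, radialTent e (r, z) * (‖h z‖ₑ ^ 2 * (K * W z)) ∂areaMeasure := by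
        rw [lintegral_areaMeasure]
        gcongr

lemma lintegral_radius_le (hW : Measurable W) {e : ℂ} (he : ‖e‖ = 1) :
    ∫⁻ r in Ioo (0 : ℝ) 1, ‖h (r * e)‖ₑ ^ 2 * (ENNReal.ofReal (1 - r) * W (r * e)) ≤
      8 * K * ∫⁻ z, ‖h z‖ₑ ^ 2 * W z ∂areaMeasure := by
  have aemeasurable_norm_sq : AEMeasurable (fun z => ‖h z‖ₑ ^ 2) areaMeasure :=
    (aestronglyMeasurable_areaMeasure hh.continuousOn).enorm.pow_const 2
  have measurable_tent := measurable_radialTent e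
  calc ∫⁻ r in Ioo (0 : ℝ) 1, ‖h (r * e)‖ₑ ^ 2 * (ENNReal.ofReal (1 - r) * W (r * e))
      ≤ ∫⁻ r in Ioo (0 : ℝ) 1,
          4 * ∫⁻ z, radialTent e (r, z) * (‖h z‖ₑ ^ 2 * (K * W z)) ∂areaMeasure :=
        setLIntegral_mono' measurableSet_Ioo fun r hr =>
          enorm_sq_mul_le_lintegral_radialTent_mul hh hdbl he hr
    _ = 4 * ∫⁻ z, (∫⁻ r in Ioo (0 : ℝ) 1, radialTent e (r, z)) *
          (‖h z‖ₑ ^ 2 * (K * W z)) ∂areaMeasure := by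
        rw [lintegral_const_mul' _ _ ENNReal.ofNat_ne_top, lintegral_lintegral_swap
          (measurable_tent.aemeasurable.mul
            (aemeasurable_norm_sq.mul (hW.const_mul K).aemeasurable).comp_snd)]
        congr 2 with z
        exact lintegral_mul_const _ (by fun_prop)
    _ ≤ 4 * ∫⁻ z, 2 * K * (‖h z‖ₑ ^ 2 * W z) ∂areaMeasure := by
        gcongr 4 * ?_
        refine lintegral_mono_ae (ae_mem_disc.mono fun z hz => ?_)
        rw [mul_left_comm _ K, ← mul_assoc]
        gcongr
        exact lintegral_radialTent_le he hz
    _ = 8 * K * ∫⁻ z, ‖h z‖ₑ ^ 2 * W z ∂areaMeasure := by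
        rw [lintegral_const_mul'' _ (by fun_prop), ← mul_assoc, ← mul_assoc]
        norm_num

end Doubling

/-- The denominator `(1 - r) V_μ(r e) + (1 - r)²` of the integrand of `kernelSize` on the radius
through `e`. -/
def radialWeight (μ : Measure ℂ) (e : ℂ) (r : ℝ) : ℝ :=
  (1 - r) * (lintegralV μ (r * e)).toReal + (1 - r) ^ 2

lemma measurable_radialWeight (μ : Measure ℂ) [SFinite (μ.restrict disc)] (e : ℂ) :
    Measurable (radialWeight μ e) := by
  have := measurable_lintegralV μ
  unfold radialWeight
  fun_prop

lemma sq_le_radialWeight (μ : Measure ℂ) (e : ℂ) {r : ℝ} (hr : r ≤ 1) :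
    (1 - r) ^ 2 ≤ radialWeight μ e r :=
  le_add_of_nonneg_left (mul_nonneg (sub_nonneg.2 hr) ENNReal.toReal_nonneg)

lemma radialWeight_pos (μ : Measure ℂ) (e : ℂ) {r : ℝ} (hr : r < 1) : 0 < radialWeight μ e r :=
  (pow_pos (sub_pos.2 hr) 2).trans_le (sq_le_radialWeight μ e hr.le)

/-- The integral in `kernelSize` along the radius through `e`, with values in `[0, ∞]`. -/
def radialSize (μ : Measure ℂ) (e : ℂ) (ρ : ℝ) : ℝ≥0∞ :=
  ∫⁻ r in Ioo 0 ρ, ENNReal.ofReal (1 / radialWeight μ e r)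

lemma norm_div_norm {z : ℂ} (hz : z ≠ 0) : ‖z / (‖z‖ : ℂ)‖ = 1 := by
  rw [norm_div, Complex.norm_real, norm_norm, div_self (norm_ne_zero_iff.2 hz)]

lemma norm_mul_div_norm {z : ℂ} (hz : z ≠ 0) : (‖z‖ : ℂ) * (z / (‖z‖ : ℂ)) = z :=
  mul_div_cancel₀ _ (by exact_mod_cast norm_ne_zero_iff.2 hz)

lemma one_div_radialWeight_le (μ : Measure ℂ) (e : ℂ) {r ρ : ℝ} (hρ : ρ < 1) (hr : r ≤ ρ) :
    1 / radialWeight μ e r ≤ 1 / (1 - ρ) ^ 2 := by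
  have : 0 < 1 - ρ := sub_pos.2 hρ
  refine one_div_le_one_div_of_le (by positivity)
    (le_trans ?_ (sq_le_radialWeight μ e (hr.trans hρ.le)))
  gcongr

lemma integrableOn_one_div_radialWeight (μ : Measure ℂ) [SFinite (μ.restrict disc)] (e : ℂ)
    {ρ : ℝ} (hρ : ρ < 1) : IntegrableOn (fun r => 1 / radialWeight μ e r) (Ioc 0 ρ) := by
  have := measurable_radialWeight μ e
  refine Measure.integrableOn_of_bounded (M := 1 / (1 - ρ) ^ 2) measure_Ioc_lt_top.ne
    (by fun_prop : Measurable fun r => 1 / radialWeight μ e r).aestronglyMeasurable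
    ((ae_restrict_iff' measurableSet_Ioc).2 (ae_of_all _ fun r hr => ?_))
  rw [Real.norm_of_nonneg (one_div_nonneg.2 (radialWeight_pos μ e (hr.2.trans_lt hρ)).le)]
  exact one_div_radialWeight_le μ e hρ hr.2

lemma kernelSize_eq (μ : Measure ℂ) {z : ℂ} (hz : z ∈ disc) (hz0 : z ≠ 0) :
    kernelSize μ z = 1 + ∫ r in Ioc 0 ‖z‖, 1 / radialWeight μ (z / (‖z‖ : ℂ)) r := by
  rw [kernelSize, intervalIntegral.integral_of_le (norm_nonneg z)]
  congr 1
  refine setIntegral_congr_fun measurableSet_Ioc fun r hr => ?_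
  simp only [radialWeight]
  rw [mul_div_assoc, V_eq_toReal
    (ofReal_mul_mem_disc (norm_div_norm hz0) hr.1.le (hr.2.trans_lt (mem_disc.1 hz)))]

lemma ofReal_kernelSize (μ : Measure ℂ) [SFinite (μ.restrict disc)] {z : ℂ} (hz : z ∈ disc)
    (hz0 : z ≠ 0) :
    ENNReal.ofReal (kernelSize μ z) = 1 + radialSize μ (z / (‖z‖ : ℂ)) ‖z‖ := by
  have integrand_nonneg :
      ∀ᵐ r ∂volume.restrict (Ioc 0 ‖z‖), 0 ≤ 1 / radialWeight μ (z / (‖z‖ : ℂ)) r :=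
    (ae_restrict_iff' measurableSet_Ioc).2 (ae_of_all _ fun r hr =>
      one_div_nonneg.2 (radialWeight_pos μ _ (hr.2.trans_lt (mem_disc.1 hz))).le)
  rw [kernelSize_eq μ hz hz0,
    ENNReal.ofReal_add zero_le_one (integral_nonneg_of_ae integrand_nonneg), ENNReal.ofReal_one,
    ofReal_integral_eq_lintegral_ofReal (integrableOn_one_div_radialWeight μ _ (mem_disc.1 hz))
      integrand_nonneg, radialSize, restrict_Ioo_eq_restrict_Ioc]

/-- The square of the norm of `D_ω`, with values in `[0, ∞]`. -/
def dirichletNormSq (ω : ℂ → ℝ≥0∞) (f : ℂ → ℂ) : ℝ≥0∞ :=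
  ∑' n, ‖taylorCoeff f n‖ₑ ^ 2 + dirichletIntegral ω f

lemma sq_lintegral_le_mul {α : Type*} [MeasurableSpace α] {m : Measure α} {F : α → ℝ≥0∞}
    {ψ : α → ℝ} (hF : AEMeasurable F m) (hψ : AEMeasurable ψ m) (hpos : ∀ᵐ x ∂m, 0 < ψ x) :
    (∫⁻ x, F x ∂m) ^ 2 ≤
      (∫⁻ x, F x ^ 2 * ENNReal.ofReal (ψ x) ∂m) * ∫⁻ x, ENNReal.ofReal (1 / ψ x) ∂m := by
  have factorization : ∫⁻ x, F x ∂m = ∫⁻ x, (F x ^ 2 * ENNReal.ofReal (ψ x)) ^ (2⁻¹ : ℝ) *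
      ENNReal.ofReal (1 / ψ x) ^ (2⁻¹ : ℝ) ∂m := by
    refine lintegral_congr_ae (hpos.mono fun x hx => ?_)
    beta_reduce
    rw [← ENNReal.mul_rpow_of_nonneg _ _ (by norm_num), mul_assoc, ← ENNReal.ofReal_mul hx.le,
      mul_one_div_cancel hx.ne', ENNReal.ofReal_one, mul_one, ← ENNReal.rpow_two,
      ← ENNReal.rpow_mul]
    norm_num
  have hoelder := ENNReal.lintegral_mul_norm_pow_le (μ := m)
    (f := fun x => F x ^ 2 * ENNReal.ofReal (ψ x)) (g := fun x => ENNReal.ofReal (1 / ψ x))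
    (by fun_prop) (p := 2⁻¹) (q := 2⁻¹) (by fun_prop) (by norm_num) (by norm_num) (by norm_num)
  rw [factorization]
  refine (pow_le_pow_left' hoelder 2).trans_eq ?_
  rw [mul_pow, ← ENNReal.rpow_two, ← ENNReal.rpow_two, ← ENNReal.rpow_mul, ← ENNReal.rpow_mul]
  norm_num

lemma enorm_sub_le_lintegral_radius {f : ℂ → ℂ} (hf : DifferentiableOn ℂ f disc) {e : ℂ}
    (he : ‖e‖ = 1) {ρ : ℝ} (hρ0 : 0 ≤ ρ) (hρ : ρ < 1) :
    ‖f (ρ * e) - f 0‖ₑ ≤ ∫⁻ r in Ioo 0 ρ, ‖deriv f (r * e)‖ₑ := by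
  have radius_mem : ∀ r ∈ uIcc 0 ρ, (r : ℂ) * e ∈ disc := fun r hr => by
    rw [uIcc_of_le hρ0] at hr
    exact ofReal_mul_mem_disc he hr.1 (hr.2.trans_lt hρ)
  have continuousOn_deriv : ContinuousOn (fun r : ℝ => deriv f (r * e) * e) (uIcc 0 ρ) :=
    ((differentiableOn_deriv hf).continuousOn.comp (by fun_prop) radius_mem).mul continuousOn_const
  have hasDerivAt : ∀ r ∈ uIcc 0 ρ,
      HasDerivAt (fun r : ℝ => f (r * e)) (deriv f (r * e) * e) r := fun r hr =>
    ((hf.differentiableAt (isOpen_disc.mem_nhds (radius_mem r hr))).hasDerivAt.comp r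
      ((Complex.ofRealCLM.hasDerivAt (x := r)).mul_const e)).congr_deriv (by simp)
  have ftc := intervalIntegral.integral_eq_sub_of_hasDerivAt hasDerivAt
    continuousOn_deriv.intervalIntegrable
  simp only [Complex.ofReal_zero, zero_mul] at ftc
  rw [← ftc, intervalIntegral.integral_of_le hρ0, integral_Ioc_eq_integral_Ioo]
  refine (enorm_integral_le_lintegral_enorm _).trans_eq (lintegral_congr fun r => ?_)
  rw [enorm_mul, ← ofReal_norm e, he, ENNReal.ofReal_one, mul_one]

lemma lintegralV_add_dirac (μ : Measure ℂ) (z : ℂ) :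
    lintegralV (μ + Measure.dirac 0) z = lintegralV μ z + ENNReal.ofReal (1 - ‖z‖ ^ 2) := by
  have restrict_dirac : (Measure.dirac (0 : ℂ)).restrict disc = Measure.dirac 0 :=
    Measure.restrict_eq_self_of_ae_mem (by simp [ae_dirac_eq, mem_disc])
  rw [lintegralV, Measure.restrict_add, restrict_dirac, lintegral_add_measure, lintegral_dirac,
    lintegralV]
  simp [berezinKernel]

section UpperBound

variable {ω : ℂ → ℝ≥0∞} {μ : Measure ℂ} (hω : IsPureSuperharmonicWeight ω μ) {f : ℂ → ℂ}
  (hf : DifferentiableOn ℂ f disc)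
include hω hf

lemma lintegral_deriv_sq_mul_lintegralV_add_dirac_le :
    ∫⁻ z, ‖deriv f z‖ₑ ^ 2 * lintegralV (μ + Measure.dirac 0) z ∂areaMeasure ≤
      2 * dirichletNormSq ω f := by
  have : AEMeasurable (fun z => ‖deriv f z‖ₑ ^ 2) areaMeasure :=
    (aestronglyMeasurable_areaMeasure
      (differentiableOn_deriv hf).continuousOn).enorm.pow_const 2
  have green_part : ∫⁻ z, ‖deriv f z‖ₑ ^ 2 * lintegralV μ z ∂areaMeasure ≤
      2 * dirichletIntegral ω f := by
    rw [dirichletIntegral, ← lintegral_const_mul' _ _ ENNReal.ofNat_ne_top]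
    refine lintegral_mono_ae (ae_mem_disc.mono fun z hz => ?_)
    rw [hω.eq_green z hz, mul_left_comm]
    gcongr
    exact lintegralV_le_two_mul_greenPotential μ hz
  simp only [lintegralV_add_dirac, mul_add]
  rw [lintegral_add_right' _ (by fun_prop), dirichletNormSq, mul_add, add_comm]
  gcongr
  refine (lintegral_deriv_sq_mul_one_sub_sq_le hf).trans ?_
  rw [two_mul]
  exact le_self_add

lemma lintegral_deriv_sq_mul_radialWeight_le {e : ℂ} (he : ‖e‖ = 1) :
    ∫⁻ r in Ioo (0 : ℝ) 1, ‖deriv f (r * e)‖ₑ ^ 2 * ENNReal.ofReal (radialWeight μ e r) ≤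
      144 * dirichletNormSq ω f := by
  set ν := μ + Measure.dirac 0
  have := sFinite_restrict_disc hω.riesz_finite
  have : SFinite (ν.restrict disc) := by rw [Measure.restrict_add]; infer_instance
  calc ∫⁻ r in Ioo (0 : ℝ) 1, ‖deriv f (r * e)‖ₑ ^ 2 * ENNReal.ofReal (radialWeight μ e r)
      ≤ ∫⁻ r in Ioo (0 : ℝ) 1,
          ‖deriv f (r * e)‖ₑ ^ 2 * (ENNReal.ofReal (1 - r) * lintegralV ν (r * e)) := by
        refine setLIntegral_mono' measurableSet_Ioo fun r hr => ?_
        have hr1 : 0 ≤ 1 - r := sub_nonneg.2 hr.2.le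
        rw [radialWeight, lintegralV_add_dirac, norm_ofReal_mul he hr.1.le,
          ENNReal.ofReal_add (mul_nonneg hr1 ENNReal.toReal_nonneg) (by positivity),
          ENNReal.ofReal_mul hr1, ENNReal.ofReal_toReal (lintegralV_lt_top hω.riesz_finite
            (ofReal_mul_mem_disc he hr.1.le hr.2)).ne,
          mul_add (ENNReal.ofReal (1 - r)), ← ENNReal.ofReal_mul hr1]
        gcongr
        rw [sq]
        exact mul_le_mul_of_nonneg_left (by nlinarith [hr.1, hr.2]) hr1
    _ ≤ 8 * 9 * ∫⁻ z, ‖deriv f z‖ₑ ^ 2 * lintegralV ν z ∂areaMeasure :=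
        lintegral_radius_le (differentiableOn_deriv hf)
          (fun c hc z hz => lintegralV_le_nine_mul hc hz ν) (measurable_lintegralV ν) he
    _ ≤ 8 * 9 * (2 * dirichletNormSq ω f) := by
        gcongr
        exact lintegral_deriv_sq_mul_lintegralV_add_dirac_le hω hf
    _ = 144 * dirichletNormSq ω f := by
        rw [← mul_assoc]
        norm_num

lemma enorm_sub_sq_le_radialSize_mul {e : ℂ} (he : ‖e‖ = 1) {ρ : ℝ} (hρ0 : 0 ≤ ρ) (hρ : ρ < 1) :
    ‖f (ρ * e) - f 0‖ₑ ^ 2 ≤ 144 * dirichletNormSq ω f * radialSize μ e ρ := by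
  have := sFinite_restrict_disc hω.riesz_finite
  have continuousOn_deriv : ContinuousOn (fun r : ℝ => deriv f (r * e)) (Ioo 0 ρ) :=
    (differentiableOn_deriv hf).continuousOn.comp (by fun_prop) fun r hr =>
      ofReal_mul_mem_disc he hr.1.le (hr.2.trans hρ)
  have cauchy_schwarz := sq_lintegral_le_mul (m := volume.restrict (Ioo 0 ρ))
    (F := fun r : ℝ => ‖deriv f (r * e)‖ₑ) (ψ := radialWeight μ e)
    (continuousOn_deriv.aestronglyMeasurable measurableSet_Ioo).enorm
    (measurable_radialWeight μ e).aemeasurable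
    ((ae_restrict_iff' measurableSet_Ioo).2 (ae_of_all _ fun r hr =>
      radialWeight_pos μ e (hr.2.trans hρ)))
  refine (pow_le_pow_left' (enorm_sub_le_lintegral_radius hf he hρ0 hρ) 2).trans
    (cauchy_schwarz.trans ?_)
  rw [radialSize]
  gcongr
  exact (lintegral_mono_set (Ioo_subset_Ioo_right hρ.le)).trans
    (lintegral_deriv_sq_mul_radialWeight_le hω hf he)

lemma enorm_sq_le_kernelSize_mul {z : ℂ} (hz : z ∈ disc) (hz0 : z ≠ 0) :
    ‖f z‖ₑ ^ 2 ≤ 288 * ENNReal.ofReal (kernelSize μ z) * dirichletNormSq ω f := by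
  have := sFinite_restrict_disc hω.riesz_finite
  set e : ℂ := z / (‖z‖ : ℂ)
  have increment_le := enorm_sub_sq_le_radialSize_mul hω hf (norm_div_norm hz0) (norm_nonneg z)
    (mem_disc.1 hz)
  rw [norm_mul_div_norm hz0] at increment_le
  have value_zero_le : ‖f 0‖ₑ ^ 2 ≤ dirichletNormSq ω f := by
    rw [dirichletNormSq, ← taylorCoeff_zero f]
    exact (ENNReal.le_tsum (f := fun n => ‖taylorCoeff f n‖ₑ ^ 2) 0).trans le_self_add
  have parallelogram : ‖f z‖ₑ ^ 2 ≤ 2 * (‖f 0‖ₑ ^ 2 + ‖f z - f 0‖ₑ ^ 2) := by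
    have := (pow_le_pow_left' (nnnorm_add_le (f 0) (f z - f 0)) 2).trans add_sq_le
    rw [add_sub_cancel] at this
    simp only [enorm_eq_nnnorm]
    exact_mod_cast this
  rw [ofReal_kernelSize μ hz hz0]
  calc ‖f z‖ₑ ^ 2
      ≤ 2 * (144 * dirichletNormSq ω f + 144 * dirichletNormSq ω f * radialSize μ e ‖z‖) := by
        refine parallelogram.trans ?_
        gcongr
        exact value_zero_le.trans (le_mul_of_one_le_left' (by norm_num))
    _ = 288 * (1 + radialSize μ e ‖z‖) * dirichletNormSq ω f := by ring

end UpperBound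
lemma lintegral_sqrt_div_sqrt_mul_left_le {x : ℝ} (hx : x ∈ Ioo (0 : ℝ) 1) :
    ∫⁻ y in Ioo 0 x, ENNReal.ofReal (√(1 - x) / √(1 - y) * (1 / (1 - y))) ≤ 2 := by
  have hsx : 0 < √(1 - x) := Real.sqrt_pos.2 (sub_pos.2 hx.2)
  have hs : ∀ y ≤ x, 0 < √(1 - y) := fun y hy => Real.sqrt_pos.2 (by linarith [hx.2])
  rw [lintegral_deriv_of_nonneg (G := fun y => 2 * √(1 - x) / √(1 - y)) hx.1.le
    (continuousOn_const.div (by fun_prop) fun y hy => (hs y hy.2).ne')]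
  · rw [sub_zero, Real.sqrt_one, mul_div_cancel_right₀ _ hsx.ne', ← ENNReal.ofReal_ofNat]
    exact ENNReal.ofReal_le_ofReal (by linarith)
  · intro y hy
    have hy0 : 0 < 1 - y := by linarith [hy.2, hx.2]
    have hsy := hs y hy.2.le
    refine ((hasDerivAt_const y (2 * √(1 - x))).div
      (((hasDerivAt_id y).const_sub 1).sqrt hy0.ne') hsy.ne').congr_deriv ?_
    simp only [id, zero_mul, zero_sub, Real.sq_sqrt hy0.le]
    field_simp
  · intro y hy
    have hy0 : 0 < 1 - y := by linarith [hy.2, hx.2]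
    positivity

lemma lintegral_sqrt_div_sqrt_mul_right {x : ℝ} (hx : x < 1) :
    ∫⁻ y in Ioo x 1, ENNReal.ofReal (√(1 - x) / √(1 - y) * (1 / (1 - x))) = 2 := by
  have hx0 : 0 < 1 - x := sub_pos.2 hx
  have hsx : 0 < √(1 - x) := Real.sqrt_pos.2 hx0
  rw [lintegral_deriv_of_nonneg (G := fun y => -(2 * √(1 - y)) / √(1 - x)) hx.le (by fun_prop)]
  · rw [sub_self, Real.sqrt_zero, mul_zero, neg_zero, zero_div, zero_sub, neg_div, neg_neg,
      mul_div_cancel_right₀ _ hsx.ne', ENNReal.ofReal_ofNat]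
  · intro y hy
    have hy0 : 0 < 1 - y := by linarith [hy.2]
    have : 0 < √(1 - y) := Real.sqrt_pos.2 hy0
    refine (((((hasDerivAt_id y).const_sub 1).sqrt hy0.ne').const_mul 2).neg.div_const
      (√(1 - x))).congr_deriv ?_
    simp only [id]
    field_simp
    rw [Real.sq_sqrt hx0.le]
  · intro y _
    positivity

/-- The Hilbert type kernel `1 / (1 - x y)` multiplied by the ratio of the values at `y` and `x` of
the test weight `(1 - t) ^ (-1 / 2)` of Schur's test. -/
def schurKernel (x y : ℝ) : ℝ≥0∞ :=
  ENNReal.ofReal (√(1 - x) / √(1 - y) * (1 / (1 - x * y)))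

lemma measurable_schurKernel : Measurable fun p : ℝ × ℝ => schurKernel p.1 p.2 := by
  unfold schurKernel
  fun_prop

lemma lintegral_schurKernel_le {x : ℝ} (hx : x ∈ Ioo (0 : ℝ) 1) :
    ∫⁻ y in Ioo (0 : ℝ) 1, schurKernel x y ≤ 4 := by
  have left : ∫⁻ y in Ioo 0 x, schurKernel x y ≤ 2 := by
    refine (setLIntegral_mono' measurableSet_Ioo fun y hy => ENNReal.ofReal_le_ofReal ?_).trans
      (lintegral_sqrt_div_sqrt_mul_left_le hx)
    have : 0 < 1 - y := by linarith [hy.2, hx.2]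
    gcongr
    nlinarith [hy.1, hx.2]
  have right : ∫⁻ y in Ico x 1, schurKernel x y ≤ 2 := by
    rw [setLIntegral_congr Ioo_ae_eq_Ico.symm, ← lintegral_sqrt_div_sqrt_mul_right hx.2]
    refine setLIntegral_mono' measurableSet_Ioo fun y hy => ENNReal.ofReal_le_ofReal ?_
    have : 0 < 1 - x := sub_pos.2 hx.2
    gcongr
    nlinarith [hx.1, hy.2]
  rw [← Ioo_union_Ico_eq_Ioo hx.1 hx.2.le]
  calc _ ≤ _ := lintegral_union_le _ _ _
    _ ≤ 2 + 2 := add_le_add left right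
    _ = 4 := by norm_num

lemma mul_mul_ofReal_le_schurKernel {x y : ℝ} (hx : x < 1) (hy : y < 1) (a b : ℝ≥0∞) :
    a * b * ENNReal.ofReal (1 / (1 - x * y)) ≤
      a ^ 2 * schurKernel x y + b ^ 2 * schurKernel y x := by
  have : 0 < √(1 - x) := Real.sqrt_pos.2 (sub_pos.2 hx)
  have : 0 < √(1 - y) := Real.sqrt_pos.2 (sub_pos.2 hy)
  rw [schurKernel, schurKernel, ENNReal.ofReal_mul (by positivity),
    ENNReal.ofReal_mul (by positivity), mul_comm y x, ← mul_assoc, ← mul_assoc, ← add_mul]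
  gcongr
  set p := ENNReal.ofReal (√(1 - x) / √(1 - y)) with hp
  set q := ENNReal.ofReal (√(1 - y) / √(1 - x)) with hq
  have hpq : p * q = 1 := by
    rw [hp, hq, ← ENNReal.ofReal_mul (by positivity), div_mul_div_comm, mul_comm (√(1 - y)),
      div_self (by positivity), ENNReal.ofReal_one]
  rcases le_total b (a * p) with h | h
  · calc a * b ≤ a * (a * p) := by gcongr
      _ = a ^ 2 * p := by ring
      _ ≤ _ := le_self_add
  · calc a * b = a * p * q * b := by rw [mul_assoc a, hpq, mul_one]
      _ ≤ b * q * b := by gcongr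
      _ = b ^ 2 * q := by ring
      _ ≤ _ := le_add_self

section Hilbert

variable {d : ℝ → ℝ≥0∞} {ρ : ℝ}

lemma lintegral_lintegral_sq_mul_schurKernel_le (d : ℝ → ℝ≥0∞) (hρ : ρ ≤ 1) :
    ∫⁻ x in Ioo 0 ρ, ∫⁻ y in Ioo 0 ρ, d x ^ 2 * schurKernel x y ≤
      4 * ∫⁻ x in Ioo 0 ρ, d x ^ 2 := by
  rw [← lintegral_const_mul' _ _ (by simp)]
  refine setLIntegral_mono' measurableSet_Ioo fun x hx => ?_
  have hk : Measurable (schurKernel x) := measurable_schurKernel.comp measurable_prodMk_left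
  rw [lintegral_const_mul _ hk, mul_comm]
  gcongr
  exact (lintegral_mono_set (Ioo_subset_Ioo_right hρ)).trans
    (lintegral_schurKernel_le ⟨hx.1, hx.2.trans_le hρ⟩)

lemma lintegral_lintegral_hilbert_le (hd : Measurable d) (hρ : ρ ≤ 1) :
    ∫⁻ x in Ioo 0 ρ, ∫⁻ y in Ioo 0 ρ, d x * d y * ENNReal.ofReal (1 / (1 - x * y)) ≤
      8 * ∫⁻ x in Ioo 0 ρ, d x ^ 2 := by
  have hk : Measurable fun p : ℝ × ℝ => d p.1 ^ 2 * schurKernel p.1 p.2 :=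
    ((hd.comp measurable_fst).pow_const 2).mul measurable_schurKernel
  calc _ ≤ ∫⁻ x in Ioo 0 ρ, ∫⁻ y in Ioo 0 ρ,
          (d x ^ 2 * schurKernel x y + d y ^ 2 * schurKernel y x) :=
        setLIntegral_mono' measurableSet_Ioo fun x hx =>
          setLIntegral_mono' measurableSet_Ioo fun y hy =>
            mul_mul_ofReal_le_schurKernel (hx.2.trans_le hρ) (hy.2.trans_le hρ) _ _
    _ = ∫⁻ x in Ioo 0 ρ, ((∫⁻ y in Ioo 0 ρ, d x ^ 2 * schurKernel x y) +
          ∫⁻ y in Ioo 0 ρ, d y ^ 2 * schurKernel y x) :=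
        lintegral_congr fun x => lintegral_add_left (hk.comp measurable_prodMk_left) _
    _ = (∫⁻ x in Ioo 0 ρ, ∫⁻ y in Ioo 0 ρ, d x ^ 2 * schurKernel x y) +
          ∫⁻ x in Ioo 0 ρ, ∫⁻ y in Ioo 0 ρ, d y ^ 2 * schurKernel y x :=
        lintegral_add_left hk.lintegral_prod_right' _
    _ = (∫⁻ x in Ioo 0 ρ, ∫⁻ y in Ioo 0 ρ, d x ^ 2 * schurKernel x y) +
          ∫⁻ x in Ioo 0 ρ, ∫⁻ y in Ioo 0 ρ, d x ^ 2 * schurKernel x y := by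
        congr 1
        exact lintegral_lintegral_swap (hk.comp measurable_swap).aemeasurable
    _ ≤ 4 * (∫⁻ x in Ioo 0 ρ, d x ^ 2) + 4 * ∫⁻ x in Ioo 0 ρ, d x ^ 2 :=
        add_le_add (lintegral_lintegral_sq_mul_schurKernel_le d hρ)
          (lintegral_lintegral_sq_mul_schurKernel_le d hρ)
    _ = _ := by rw [← add_mul]; norm_num

end Hilbert

lemma enorm_geom_sum_le {q : ℂ} (hq : ‖q‖ < 1) (N : ℕ) :
    ‖∑ n ∈ Finset.range N, q ^ n‖ₑ ≤ 2 * ENNReal.ofReal (1 / ‖1 - q‖) := by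
  have hq1 : 1 - q ≠ 0 := sub_ne_zero.2 (by rintro rfl; simp at hq)
  rw [← ofReal_norm, ← ENNReal.ofReal_ofNat, ← ENNReal.ofReal_mul zero_le_two, mul_one_div]
  refine ENNReal.ofReal_le_ofReal ?_
  rw [le_div_iff₀ (norm_pos_iff.2 hq1), ← norm_mul, geom_sum_mul_neg]
  calc ‖1 - q ^ N‖ ≤ ‖(1 : ℂ)‖ + ‖q ^ N‖ := norm_sub_le _ _
    _ ≤ 1 + 1 := by
      rw [norm_one, norm_pow]
      gcongr
      exact pow_le_one₀ (norm_nonneg q) hq.le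
    _ = 2 := one_add_one_eq_two

lemma enorm_sum_mul_conj (b : ℕ → ℂ) (s : Finset ℕ) :
    ‖∑ n ∈ s, b n * conj (b n)‖ₑ = ∑ n ∈ s, ‖b n‖ₑ ^ 2 := by
  simp only [RCLike.mul_conj, enorm_sq_eq_ofReal]
  rw [← ENNReal.ofReal_sum_of_nonneg fun n _ => by positivity, ← ofReal_norm]
  norm_cast
  rw [abs_of_nonneg (Finset.sum_nonneg fun n _ => by positivity)]

lemma norm_conj_mul_lt_one {u v : ℂ} (hu : ‖u‖ ≤ 1) (hv : ‖v‖ < 1) : ‖conj u * v‖ < 1 := by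
  rw [norm_mul, RCLike.norm_conj]
  exact mul_lt_one_of_nonneg_of_lt_one_right hu (norm_nonneg v) hv

/-- The superposition `∫ H(x) / (1 - conj p(x) z) dm(x)` of the Szegő kernels at the points `p(x)`
of the disc. -/
def szegoIntegral {α : Type*} [MeasurableSpace α] (m : Measure α) (H p : α → ℂ) (z : ℂ) : ℂ :=
  ∫ x, H x * (1 / (1 - conj (p x) * z)) ∂m

section SzegoIntegral

variable {α : Type*} [MeasurableSpace α] {m : Measure α} {H p : α → ℂ}

lemma integrable_mul_conj_pow (hH : Integrable H m) (hp : AEStronglyMeasurable p m)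
    (hp1 : ∀ᵐ x ∂m, ‖p x‖ ≤ 1) (n : ℕ) : Integrable (fun x => H x * conj (p x) ^ n) m := by
  refine hH.mul_bdd (c := 1) ((Complex.continuous_conj.comp_aestronglyMeasurable hp).pow n)
    (hp1.mono fun x hx => ?_)
  rw [norm_pow, RCLike.norm_conj]
  exact pow_le_one₀ (norm_nonneg _) hx

lemma hasSum_integral_mul_conj_pow_mul (hH : Integrable H m) (hp : AEStronglyMeasurable p m)
    (hp1 : ∀ᵐ x ∂m, ‖p x‖ ≤ 1) {a : ℕ → ℂ} (ha : Summable fun n => ‖a n‖) {s : α → ℂ}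
    (hs : ∀ᵐ x ∂m, HasSum (fun n => conj (p x) ^ n * a n) (s x)) :
    HasSum (fun n => (∫ x, H x * conj (p x) ^ n ∂m) * a n) (∫ x, H x * s x ∂m) := by
  simp only [← integral_mul_const]
  refine hasSum_integral_of_dominated_convergence (fun n x => ‖H x‖ * ‖a n‖)
    (fun n => ((integrable_mul_conj_pow hH hp hp1 n).mul_const _).aestronglyMeasurable)
    (fun n => hp1.mono fun x hx => ?_) (ae_of_all _ fun x => ha.mul_left _) ?_
    (hs.mono fun x hx => ?_)
  · rw [norm_mul, norm_mul, norm_pow, RCLike.norm_conj]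
    gcongr
    exact mul_le_of_le_one_right (norm_nonneg _) (pow_le_one₀ (norm_nonneg _) hx)
  · simp only [tsum_mul_left]
    exact hH.norm.mul_const _
  · simpa only [mul_assoc] using hx.mul_left (H x)

lemma hasSum_succ_mul_integral_mul_conj_pow (hH : Integrable H m) (hp : AEStronglyMeasurable p m)
    (hp1 : ∀ᵐ x ∂m, ‖p x‖ ≤ 1) {z : ℂ} (hz : ‖z‖ < 1) :
    HasSum (fun n : ℕ => (n + 1) * (∫ x, H x * conj (p x) ^ n ∂m) * z ^ n)
      (∫ x, H x * (1 / (1 - conj (p x) * z) ^ 2) ∂m) := by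
  refine (hasSum_integral_mul_conj_pow_mul hH hp hp1 (a := fun n => (n + 1) * z ^ n)
    (hasSum_succ_mul_geometric hz).summable.norm (hp1.mono fun x hx => ?_)).congr_fun
      fun n => by ring
  refine (hasSum_succ_mul_geometric (norm_conj_mul_lt_one hx hz)).congr_fun fun n => ?_
  rw [mul_pow]
  ring

lemma hasSum_szegoIntegral (hH : Integrable H m) (hp : AEStronglyMeasurable p m)
    (hp1 : ∀ᵐ x ∂m, ‖p x‖ ≤ 1) {z : ℂ} (hz : z ∈ disc) :
    HasSum (fun n : ℕ => (∫ x, H x * conj (p x) ^ n ∂m) * z ^ n) (szegoIntegral m H p z) := by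
  have hz1 := mem_disc.1 hz
  refine hasSum_integral_mul_conj_pow_mul hH hp hp1 ?_ (hp1.mono fun x hx => ?_)
  · simpa only [norm_pow] using summable_geometric_of_lt_one (norm_nonneg z) hz1
  · simpa only [mul_pow, one_div] using
      hasSum_geometric_of_norm_lt_one (norm_conj_mul_lt_one hx hz1)

lemma differentiableOn_szegoIntegral (hH : Integrable H m) (hp : AEStronglyMeasurable p m)
    (hp1 : ∀ᵐ x ∂m, ‖p x‖ ≤ 1) : DifferentiableOn ℂ (szegoIntegral m H p) disc :=
  differentiableOn_of_hasSum fun _ hz => hasSum_szegoIntegral hH hp hp1 hz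

lemma deriv_szegoIntegral (hH : Integrable H m) (hp : AEStronglyMeasurable p m)
    (hp1 : ∀ᵐ x ∂m, ‖p x‖ ≤ 1) {z : ℂ} (hz : z ∈ disc) :
    deriv (szegoIntegral m H p) z =
      ∫ x, H x * conj (p x) * (1 / (1 - conj (p x) * z) ^ 2) ∂m := by
  have hHp : Integrable (fun x => H x * conj (p x)) m := by
    simpa only [pow_one] using integrable_mul_conj_pow hH hp hp1 1
  refine (hasSum_deriv_of_hasSum (fun _ hz => hasSum_szegoIntegral hH hp hp1 hz) hz).unique
    ((hasSum_succ_mul_integral_mul_conj_pow hHp hp hp1 (mem_disc.1 hz)).congr_fun fun n => ?_)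
  simp only [pow_succ', mul_assoc]

variable [SFinite m]

lemma sum_enorm_integral_mul_conj_pow_sq_le (hH : Integrable H m) (hp : AEStronglyMeasurable p m)
    (hp1 : ∀ᵐ x ∂m, ‖p x‖ ≤ 1) (N : ℕ) :
    ∑ n ∈ Finset.range N, ‖∫ x, H x * conj (p x) ^ n ∂m‖ₑ ^ 2 ≤
      ∫⁻ x, ∫⁻ y, ‖H x‖ₑ * ‖H y‖ₑ *
        ‖∑ n ∈ Finset.range N, (conj (p x) * p y) ^ n‖ₑ ∂m ∂m := by
  have hint : ∀ n : ℕ, Integrable (fun q : α × α =>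
      H q.1 * conj (p q.1) ^ n * conj (H q.2 * conj (p q.2) ^ n)) (m.prod m) := fun n =>
    (integrable_mul_conj_pow hH hp hp1 n).mul_prod
      (Complex.conjCLE.toContinuousLinearMap.integrable_comp
        (integrable_mul_conj_pow hH hp hp1 n))
  have hprod : ∀ n : ℕ,
      (∫ x, H x * conj (p x) ^ n ∂m) * conj (∫ x, H x * conj (p x) ^ n ∂m) =
        ∫ q : α × α, H q.1 * conj (p q.1) ^ n * conj (H q.2 * conj (p q.2) ^ n) ∂m.prod m := by
    intro n
    rw [integral_prod_mul (fun x => H x * conj (p x) ^ n) (fun y => conj (H y * conj (p y) ^ n)),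
      integral_conj]
  rw [← enorm_sum_mul_conj]
  simp only [hprod]
  rw [← integral_finsetSum _ fun n _ => hint n]
  refine (enorm_integral_le_lintegral_enorm _).trans_eq ?_
  rw [lintegral_prod _ (integrable_finsetSum _ fun n _ => hint n).aestronglyMeasurable.enorm]
  refine lintegral_congr fun x => lintegral_congr fun y => ?_
  rw [← RCLike.enorm_conj (H y), ← enorm_mul, ← enorm_mul, Finset.mul_sum]
  congr 1
  refine Finset.sum_congr rfl fun n _ => ?_
  rw [map_mul, map_pow, Complex.conj_conj, mul_pow]
  ring

lemma tsum_enorm_integral_mul_conj_pow_sq_le (hH : Integrable H m)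
    (hp : AEStronglyMeasurable p m) (hp1 : ∀ᵐ x ∂m, ‖p x‖ < 1) :
    ∑' n : ℕ, ‖∫ x, H x * conj (p x) ^ n ∂m‖ₑ ^ 2 ≤
      2 * ∫⁻ x, ∫⁻ y, ‖H x‖ₑ * ‖H y‖ₑ * ENNReal.ofReal (1 / ‖1 - conj (p x) * p y‖) ∂m ∂m := by
  refine ENNReal.tsum_le_of_sum_range_le fun N =>
    (sum_enorm_integral_mul_conj_pow_sq_le hH hp (hp1.mono fun _ => le_of_lt) N).trans ?_
  simp only [← lintegral_const_mul' _ _ ENNReal.ofNat_ne_top]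
  refine lintegral_mono_ae (hp1.mono fun x hx => lintegral_mono_ae (hp1.mono fun y hy => ?_))
  rw [mul_left_comm 2]
  gcongr
  exact enorm_geom_sum_le (norm_conj_mul_lt_one hx.le hy) N

lemma tsum_taylorCoeff_szegoIntegral_sq_le (hH : Integrable H m) (hp : AEStronglyMeasurable p m)
    (hp1 : ∀ᵐ x ∂m, ‖p x‖ < 1) :
    ∑' n, ‖taylorCoeff (szegoIntegral m H p) n‖ₑ ^ 2 ≤
      2 * ∫⁻ x, ∫⁻ y, ‖H x‖ₑ * ‖H y‖ₑ * ENNReal.ofReal (1 / ‖1 - conj (p x) * p y‖) ∂m ∂m := by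
  simp only [taylorCoeff_eq_of_hasSum fun _ hz =>
    hasSum_szegoIntegral hH hp (hp1.mono fun _ => le_of_lt) hz]
  exact tsum_enorm_integral_mul_conj_pow_sq_le hH hp hp1

end SzegoIntegral

section Transport

variable {w a b z : ℂ} (hw : w ∈ disc) (ha : a ∈ disc)
include hw ha

lemma one_sub_conj_mul_moebius_mul (hz : z ∈ disc) :
    (1 - conj a * moebius w z) * (1 - conj w * z) =
      (1 - conj a * w) * (1 - conj (moebius w a) * z) := by
  have move_z : moebius w z * (1 - conj w * z) = w - z :=
    div_mul_cancel₀ _ (one_sub_conj_mul_ne_zero hw hz)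
  have move_a : conj (moebius w a) * (1 - w * conj a) = conj w - conj a := by
    simpa [moebius] using congrArg conj
      (div_mul_cancel₀ (w - a) (one_sub_conj_mul_ne_zero hw ha))
  linear_combination (-conj a) * move_z + z * move_a

lemma one_sub_conj_moebius_mul_moebius (hb : b ∈ disc) :
    1 - conj (moebius w a) * moebius w b =
      (1 - conj w * w) * (1 - conj a * b) / ((1 - conj a * w) * (1 - conj w * b)) := by
  have hwb := one_sub_conj_mul_ne_zero hw hb
  have haw := one_sub_conj_mul_ne_zero ha hw
  rw [eq_div_iff (mul_ne_zero haw hwb), ← mul_assoc, mul_comm (1 - conj (moebius w a) * _),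
    ← one_sub_conj_mul_moebius_mul hw ha (moebius_mem_disc hw hb), moebius_moebius hw hb,
    one_sub_conj_mul_moebius hw hb, mul_assoc, div_mul_cancel₀ _ hwb]
  ring

end Transport

/-- The density for which `∫ G(x) / (1 - conj q(x) z)² dm(x)`, with `q = moebius w ∘ p`, is the
pullback of `f' dz` under `moebius w`, where `f = szegoIntegral m H p`. -/
def transportDensity {α : Type*} (w : ℂ) (H p : α → ℂ) (x : α) : ℂ :=
  H x * conj (p x) * (-(1 - conj w * w) / (1 - conj (p x) * w) ^ 2)

lemma aestronglyMeasurable_moebius_comp {α : Type*} [MeasurableSpace α] {m : Measure α} {p : α → ℂ}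
    (w : ℂ) (hp : AEStronglyMeasurable p m) :
    AEStronglyMeasurable (fun x => moebius w (p x)) m := by
  have := hp.aemeasurable
  refine AEMeasurable.aestronglyMeasurable ?_
  unfold moebius
  fun_prop

section Transport

variable {α : Type*} {H p : α → ℂ} {w : ℂ} (hw : w ∈ disc)
include hw

lemma norm_transportDensity_le {x : α} (hx : ‖p x‖ ≤ 1) :
    ‖transportDensity w H p x‖ ≤ ‖H x‖ * ((1 - ‖w‖ ^ 2) / ‖1 - conj (p x) * w‖ ^ 2) := by
  have := one_sub_normSq_pos hw
  rw [transportDensity, norm_mul, norm_mul, norm_div, norm_neg, one_sub_conj_mul_self,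
    Complex.norm_real, Real.norm_of_nonneg this.le, norm_pow, RCLike.norm_conj]
  gcongr
  exact mul_le_of_le_one_right (norm_nonneg _) hx

lemma transportDensity_mul_kernel_le {x y : α} (hx : p x ∈ disc) (hy : p y ∈ disc) :
    ‖transportDensity w H p x‖ₑ * ‖transportDensity w H p y‖ₑ *
        ENNReal.ofReal (1 / ‖1 - conj (moebius w (p x)) * moebius w (p y)‖) ≤
      ENNReal.ofReal (1 - ‖w‖ ^ 2) * (ENNReal.ofReal (‖H x‖ / ‖1 - conj (p x) * w‖) *
        ENNReal.ofReal (‖H y‖ / ‖1 - conj (p y) * w‖) *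
          ENNReal.ofReal (1 / ‖1 - conj (p x) * p y‖)) := by
  have hw0 := one_sub_normSq_pos hw
  have hxw : 0 < ‖1 - conj (p x) * w‖ := norm_pos_iff.2 (one_sub_conj_mul_ne_zero hx hw)
  have hyw : 0 < ‖1 - conj (p y) * w‖ := norm_pos_iff.2 (one_sub_conj_mul_ne_zero hy hw)
  have hxy : 0 < ‖1 - conj (p x) * p y‖ := norm_pos_iff.2 (one_sub_conj_mul_ne_zero hx hy)
  have conj_symm : ‖1 - conj w * p y‖ = ‖1 - conj (p y) * w‖ := by
    rw [← RCLike.norm_conj, map_sub, map_mul, map_one, Complex.conj_conj, mul_comm]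
  rw [one_sub_conj_moebius_mul_moebius hw hx hy, norm_div, norm_mul, norm_mul, conj_symm,
    one_sub_conj_mul_self, Complex.norm_real, Real.norm_of_nonneg hw0.le, ← ofReal_norm,
    ← ofReal_norm]
  simp (discharger := positivity) only [← ENNReal.ofReal_mul]
  refine ENNReal.ofReal_le_ofReal ?_
  calc _ ≤ ‖H x‖ * ((1 - ‖w‖ ^ 2) / ‖1 - conj (p x) * w‖ ^ 2) *
        (‖H y‖ * ((1 - ‖w‖ ^ 2) / ‖1 - conj (p y) * w‖ ^ 2)) *
        (1 / ((1 - ‖w‖ ^ 2) * ‖1 - conj (p x) * p y‖ /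
          (‖1 - conj (p x) * w‖ * ‖1 - conj (p y) * w‖))) := by
        gcongr
        · exact norm_transportDensity_le hw (mem_disc.1 hx).le
        · exact norm_transportDensity_le hw (mem_disc.1 hy).le
    _ = _ := by field_simp

variable [MeasurableSpace α] {m : Measure α}

lemma integrable_transportDensity (hH : Integrable H m) (hp : AEStronglyMeasurable p m)
    (hp1 : ∀ᵐ x ∂m, ‖p x‖ ≤ 1) : Integrable (transportDensity w H p) m := by
  have := hH.aemeasurable
  have := hp.aemeasurable
  have meas : AEMeasurable (transportDensity w H p) m := by
    unfold transportDensity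
    fun_prop
  refine (hH.norm.mul_const ((1 - ‖w‖ ^ 2) / (1 - ‖w‖) ^ 2)).mono' meas.aestronglyMeasurable
    (hp1.mono fun x hx => (norm_transportDensity_le hw hx).trans ?_)
  have := one_sub_normSq_pos hw
  have : 0 < 1 - ‖w‖ := sub_pos.2 (mem_disc.1 hw)
  gcongr
  rw [mul_comm]
  exact one_sub_norm_le_norm_one_sub_mul_conj hx

lemma hasSum_deriv_szegoIntegral_moebius (hH : Integrable H m) (hp : AEStronglyMeasurable p m)
    (hp1 : ∀ᵐ x ∂m, p x ∈ disc) {z : ℂ} (hz : z ∈ disc) :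
    HasSum (fun n : ℕ =>
        (n + 1) * (∫ x, transportDensity w H p x * conj (moebius w (p x)) ^ n ∂m) * z ^ n)
      (deriv (szegoIntegral m H p) (moebius w z) *
        (-(1 - conj w * w) / (1 - conj w * z) ^ 2)) := by
  have norm_le_one : ∀ᵐ x ∂m, ‖p x‖ ≤ 1 := hp1.mono fun x hx => (mem_disc.1 hx).le
  convert hasSum_succ_mul_integral_mul_conj_pow (integrable_transportDensity hw hH hp norm_le_one)
    (aestronglyMeasurable_moebius_comp w hp)
    (hp1.mono fun x hx => (mem_disc.1 (moebius_mem_disc hw hx)).le) (mem_disc.1 hz) using 1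
  rw [deriv_szegoIntegral hH hp norm_le_one (moebius_mem_disc hw hz), ← integral_mul_const]
  refine integral_congr_ae (hp1.mono fun x hx => ?_)
  have kernel_eq : 1 / (1 - conj (p x) * moebius w z) ^ 2 * (1 / (1 - conj w * z) ^ 2) =
      1 / (1 - conj (p x) * w) ^ 2 * (1 / (1 - conj (moebius w (p x)) * z) ^ 2) := by
    rw [one_div_mul_one_div, one_div_mul_one_div, ← mul_pow, ← mul_pow,
      one_sub_conj_mul_moebius_mul hw hx hz]
  simp only [transportDensity]
  linear_combination (H x * conj (p x) * -(1 - conj w * w)) * kernel_eq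

lemma lintegral_deriv_szegoIntegral_sq_mul_greenKernel_le [SFinite m] (hH : Integrable H m)
    (hp : AEStronglyMeasurable p m) (hp1 : ∀ᵐ x ∂m, p x ∈ disc) :
    ∫⁻ z, ‖deriv (szegoIntegral m H p) z‖ₑ ^ 2 * greenKernel z w ∂areaMeasure ≤
      ENNReal.ofReal (1 - ‖w‖ ^ 2) * ∫⁻ x, ∫⁻ y,
        ENNReal.ofReal (‖H x‖ / ‖1 - conj (p x) * w‖) *
          ENNReal.ofReal (‖H y‖ / ‖1 - conj (p y) * w‖) *
            ENNReal.ofReal (1 / ‖1 - conj (p x) * p y‖) ∂m ∂m := by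
  have norm_le_one : ∀ᵐ x ∂m, ‖p x‖ ≤ 1 := hp1.mono fun x hx => (mem_disc.1 hx).le
  rw [lintegral_enorm_sq_mul_greenKernel hw
    (differentiableOn_deriv (differentiableOn_szegoIntegral hH hp norm_le_one)).continuousOn
    fun z hz => hasSum_deriv_szegoIntegral_moebius hw hH hp hp1 hz]
  refine (mul_le_mul_right (tsum_enorm_integral_mul_conj_pow_sq_le
    (integrable_transportDensity hw hH hp norm_le_one)
    (aestronglyMeasurable_moebius_comp w hp)
    (hp1.mono fun x hx => mem_disc.1 (moebius_mem_disc hw hx))) _).trans ?_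
  rw [← mul_assoc, ENNReal.inv_mul_cancel two_ne_zero ENNReal.ofNat_ne_top, one_mul]
  simp only [← lintegral_const_mul' _ _ ENNReal.ofReal_ne_top]
  exact lintegral_mono_ae (hp1.mono fun x hx => lintegral_mono_ae (hp1.mono fun y hy =>
    transportDensity_mul_kernel_le hw hx hy))

end Transport

lemma conj_ofReal_mul_mul_ofReal_mul {e : ℂ} (he : ‖e‖ = 1) (x y : ℝ) :
    conj ((x : ℂ) * e) * ((y : ℂ) * e) = ((x * y : ℝ) : ℂ) := by
  rw [map_mul, Complex.conj_ofReal, mul_mul_mul_comm, Complex.conj_mul', he]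
  simp

/-- The superposition `∫_0^ρ c(x) / (1 - x conj e z) dx` of the Szegő kernels at the points of the
radius through `e`. -/
def radialSzego (c : ℝ → ℂ) (e : ℂ) (ρ : ℝ) : ℂ → ℂ :=
  szegoIntegral (volume.restrict (Ioo 0 ρ)) c fun x => x * e

section RadialSzego

variable {c : ℝ → ℂ} {e : ℂ} {ρ : ℝ}

lemma aestronglyMeasurable_ofReal_mul (e : ℂ) (m : Measure ℝ) :
    AEStronglyMeasurable (fun x : ℝ => (x : ℂ) * e) m :=
  (by fun_prop : Continuous fun x : ℝ => (x : ℂ) * e).aestronglyMeasurable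

lemma ae_ofReal_mul_mem_disc (he : ‖e‖ = 1) (hρ : ρ ≤ 1) :
    ∀ᵐ x : ℝ ∂volume.restrict (Ioo 0 ρ), (x : ℂ) * e ∈ disc :=
  (ae_restrict_mem measurableSet_Ioo).mono fun _ hx =>
    ofReal_mul_mem_disc he hx.1.le (hx.2.trans_le hρ)

lemma differentiableOn_radialSzego (hc : IntegrableOn c (Ioo 0 ρ)) (he : ‖e‖ = 1) (hρ : ρ ≤ 1) :
    DifferentiableOn ℂ (radialSzego c e ρ) disc :=
  differentiableOn_szegoIntegral hc (aestronglyMeasurable_ofReal_mul e _)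
    ((ae_ofReal_mul_mem_disc he hρ).mono fun _ hx => (mem_disc.1 hx).le)

lemma lintegral_lintegral_szego_le {d : ℝ → ℝ≥0∞} (hd : Measurable d) (he : ‖e‖ = 1)
    (hρ : ρ ≤ 1) :
    ∫⁻ x in Ioo 0 ρ, ∫⁻ y in Ioo 0 ρ,
        d x * d y * ENNReal.ofReal (1 / ‖1 - conj ((x : ℂ) * e) * ((y : ℂ) * e)‖) ≤
      8 * ∫⁻ x in Ioo 0 ρ, d x ^ 2 := by
  refine le_of_eq_of_le (setLIntegral_congr_fun measurableSet_Ioo fun x hx =>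
    setLIntegral_congr_fun measurableSet_Ioo fun y hy => ?_) (lintegral_lintegral_hilbert_le hd hρ)
  have : 0 ≤ 1 - x * y := by nlinarith [hx.1, hx.2, hy.1, hy.2]
  rw [conj_ofReal_mul_mul_ofReal_mul he, ← Complex.ofReal_one, ← Complex.ofReal_sub,
    Complex.norm_real, Real.norm_of_nonneg this]

lemma tsum_taylorCoeff_radialSzego_sq_le (hcm : Measurable c) (hc : IntegrableOn c (Ioo 0 ρ))
    (he : ‖e‖ = 1) (hρ : ρ ≤ 1) :
    ∑' n, ‖taylorCoeff (radialSzego c e ρ) n‖ₑ ^ 2 ≤ 16 * ∫⁻ x in Ioo 0 ρ, ‖c x‖ₑ ^ 2 := by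
  calc _ ≤ _ := tsum_taylorCoeff_szegoIntegral_sq_le hc (aestronglyMeasurable_ofReal_mul e _)
        ((ae_ofReal_mul_mem_disc he hρ).mono fun _ => mem_disc.1)
    _ ≤ 2 * (8 * ∫⁻ x in Ioo 0 ρ, ‖c x‖ₑ ^ 2) := by
        gcongr
        exact lintegral_lintegral_szego_le hcm.enorm he hρ
    _ = _ := by rw [← mul_assoc]; norm_num

lemma lintegral_deriv_radialSzego_sq_mul_greenKernel_le (hcm : Measurable c)
    (hc : IntegrableOn c (Ioo 0 ρ)) (he : ‖e‖ = 1) (hρ : ρ ≤ 1) {w : ℂ} (hw : w ∈ disc) :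
    ∫⁻ z, ‖deriv (radialSzego c e ρ) z‖ₑ ^ 2 * greenKernel z w ∂areaMeasure ≤
      8 * ∫⁻ x in Ioo 0 ρ, ‖c x‖ₑ ^ 2 *
        (ENNReal.ofReal (1 / (1 - x ^ 2)) * ENNReal.ofReal (berezinKernel (x * e) w)) := by
  have hw0 := one_sub_normSq_pos hw
  calc _ ≤ _ := lintegral_deriv_szegoIntegral_sq_mul_greenKernel_le hw hc
        (aestronglyMeasurable_ofReal_mul e _) (ae_ofReal_mul_mem_disc he hρ)
    _ ≤ ENNReal.ofReal (1 - ‖w‖ ^ 2) * (8 * ∫⁻ x in Ioo 0 ρ,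
          ENNReal.ofReal (‖c x‖ / ‖1 - conj ((x : ℂ) * e) * w‖) ^ 2) := by
        gcongr
        exact lintegral_lintegral_szego_le (by fun_prop) he hρ
    _ = _ := by
        rw [mul_left_comm, ← lintegral_const_mul' _ _ ENNReal.ofReal_ne_top]
        congr 1
        refine setLIntegral_congr_fun measurableSet_Ioo fun x hx => ?_
        have hx0 : 0 < 1 - x ^ 2 := by nlinarith [hx.1, hx.2]
        have conj_symm : ‖1 - conj ((x : ℂ) * e) * w‖ = ‖1 - x * e * conj w‖ := by
          rw [← RCLike.norm_conj, map_sub, map_mul, map_one, Complex.conj_conj]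
        rw [berezinKernel, norm_ofReal_mul he hx.1.le, enorm_sq_eq_ofReal, conj_symm]
        simp (discharger := positivity) only [← ENNReal.ofReal_mul, ← ENNReal.ofReal_pow]
        congr 1
        field_simp

end RadialSzego

section Weight

variable {ω : ℂ → ℝ≥0∞} {μ : Measure ℂ} (hω : IsPureSuperharmonicWeight ω μ)
include hω

lemma lintegral_mul_weight {F : ℂ → ℝ≥0∞} (hF : AEMeasurable F areaMeasure) :
    ∫⁻ z, F z * ω z ∂areaMeasure =
      ∫⁻ w in disc, ∫⁻ z, F z * greenKernel z w ∂areaMeasure ∂μ := by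
  have := sFinite_restrict_disc hω.riesz_finite
  rw [lintegral_lintegral_swap]
  · refine lintegral_congr_ae (ae_mem_disc.mono fun z hz => ?_)
    have hg : Measurable (greenKernel z) := measurable_greenKernel.comp measurable_prodMk_left
    simp only
    rw [lintegral_const_mul _ hg, hω.eq_green z hz, greenPotential]
  · exact (hF.comp_quasiMeasurePreserving Measure.quasiMeasurePreserving_snd).mul
      (measurable_greenKernel.comp measurable_swap).aemeasurable

lemma aemeasurable_weight : AEMeasurable ω areaMeasure := by
  have := sFinite_restrict_disc hω.riesz_finite
  have h : Measurable (greenPotential μ) := measurable_greenKernel.lintegral_prod_right'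
  exact h.aemeasurable.congr (ae_mem_disc.mono fun z hz => (hω.eq_green z hz).symm)

lemma ae_weight_lt_top : ∀ᵐ z ∂areaMeasure, ω z < ⊤ := by
  refine ae_lt_top' (aemeasurable_weight hω) (ne_of_lt ?_)
  calc ∫⁻ z, ω z ∂areaMeasure
      = ∫⁻ w in disc, 2⁻¹ * ENNReal.ofReal (1 - ‖w‖ ^ 2) ∂μ := by
        have h := lintegral_mul_weight hω (F := fun _ => 1) aemeasurable_const
        simp only [one_mul] at h
        rw [h]
        exact setLIntegral_congr_fun measurableSet_disc fun w hw => lintegral_greenKernel_eq hw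
    _ = 2⁻¹ * ∫⁻ w in disc, ENNReal.ofReal (1 - ‖w‖ ^ 2) ∂μ :=
        lintegral_const_mul' _ _ (by simp)
    _ < ⊤ := ENNReal.mul_lt_top (by simp) hω.riesz_finite

lemma dirichletIntegral_radialSzego_le {c : ℝ → ℂ} {e : ℂ} {ρ : ℝ} (hcm : Measurable c)
    (hc : IntegrableOn c (Ioo 0 ρ)) (he : ‖e‖ = 1) (hρ : ρ ≤ 1) :
    dirichletIntegral ω (radialSzego c e ρ) ≤ 8 * ∫⁻ x in Ioo 0 ρ,
      ‖c x‖ₑ ^ 2 * (ENNReal.ofReal (1 / (1 - x ^ 2)) * lintegralV μ (x * e)) := by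
  have := sFinite_restrict_disc hω.riesz_finite
  have hdiff := differentiableOn_radialSzego hc he hρ
  rw [dirichletIntegral, lintegral_mul_weight hω ((aestronglyMeasurable_areaMeasure
    (differentiableOn_deriv hdiff).continuousOn).enorm.pow_const 2)]
  have hk : Measurable fun q : ℂ × ℝ => ENNReal.ofReal (berezinKernel (q.2 * e) q.1) :=
    (measurable_berezinKernel.comp (by fun_prop : Measurable fun q : ℂ × ℝ => (q.2 * e, q.1))
      ).ennreal_ofReal
  calc _ ≤ ∫⁻ w in disc, (8 * ∫⁻ x in Ioo 0 ρ, ‖c x‖ₑ ^ 2 *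
          (ENNReal.ofReal (1 / (1 - x ^ 2)) * ENNReal.ofReal (berezinKernel (x * e) w))) ∂μ :=
        setLIntegral_mono' measurableSet_disc fun w hw =>
          lintegral_deriv_radialSzego_sq_mul_greenKernel_le hcm hc he hρ hw
    _ = 8 * ∫⁻ x in Ioo 0 ρ, ∫⁻ w in disc, ‖c x‖ₑ ^ 2 *
          (ENNReal.ofReal (1 / (1 - x ^ 2)) * ENNReal.ofReal (berezinKernel (x * e) w)) ∂μ := by
        rw [lintegral_const_mul' _ _ (by simp), lintegral_lintegral_swap]
        fun_prop
    _ = _ := by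
        congr 1
        refine lintegral_congr fun x => ?_
        rw [lintegral_const_mul' _ _ (by simp), lintegral_const_mul' _ _ ENNReal.ofReal_ne_top,
          lintegralV]

lemma dirichletNormSq_radialSzego_le {c : ℝ → ℂ} {e : ℂ} {ρ : ℝ} (hcm : Measurable c)
    (hc : IntegrableOn c (Ioo 0 ρ)) (he : ‖e‖ = 1) (hρ : ρ ≤ 1) :
    dirichletNormSq ω (radialSzego c e ρ) ≤ 16 * ∫⁻ x in Ioo 0 ρ,
      ‖c x‖ₑ ^ 2 * (1 + ENNReal.ofReal (1 / (1 - x)) * lintegralV μ (x * e)) := by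
  have meas_sq : Measurable fun x => ‖c x‖ₑ ^ 2 := hcm.enorm.pow_const 2
  simp only [mul_add, mul_one]
  rw [lintegral_add_left meas_sq, mul_add, dirichletNormSq]
  refine add_le_add (tsum_taylorCoeff_radialSzego_sq_le hcm hc he hρ)
    ((dirichletIntegral_radialSzego_le hω hcm hc he hρ).trans ?_)
  refine mul_le_mul' (by norm_num) (setLIntegral_mono' measurableSet_Ioo fun x hx => ?_)
  have : 0 < 1 - x := by linarith [hx.2]
  gcongr
  nlinarith [hx.1]

end Weight

lemma memDirichlet_of_dirichletNormSq_lt_top {ω : ℂ → ℝ≥0∞} {f : ℂ → ℂ}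
    (hf : DifferentiableOn ℂ f disc) (h : dirichletNormSq ω f < ⊤) : MemDirichlet ω f := by
  rw [dirichletNormSq, ENNReal.add_lt_top] at h
  exact ⟨⟨hf, by simpa using ENNReal.summable_toReal h.1.ne⟩, h.2⟩

/-- The density for which `‖c‖² (1 + V / (1 - x)) = 1 / radialWeight`; `radialSzego` of it is the
test function for the lower estimate of the reproducing kernel. -/
def testDensity (μ : Measure ℂ) (e : ℂ) (x : ℝ) : ℝ :=
  (1 - x) / radialWeight μ e x

section TestFunction

variable (μ : Measure ℂ) (e : ℂ) {ρ : ℝ}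

lemma testDensity_pos {x : ℝ} (hx : x < 1) : 0 < testDensity μ e x :=
  div_pos (sub_pos.2 hx) (radialWeight_pos μ e hx)

lemma testDensity_sq_mul_eq (hμ : ∫⁻ w in disc, ENNReal.ofReal (1 - ‖w‖ ^ 2) ∂μ < ⊤)
    (he : ‖e‖ = 1) {x : ℝ} (hx0 : 0 ≤ x) (hx : x < 1) :
    ‖(testDensity μ e x : ℂ)‖ₑ ^ 2 * (1 + ENNReal.ofReal (1 / (1 - x)) * lintegralV μ (x * e)) =
      ENNReal.ofReal (1 / radialWeight μ e x) := by
  have hψ := radialWeight_pos μ e hx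
  have one_sub_pos : 0 < 1 - x := sub_pos.2 hx
  rw [← ENNReal.ofReal_toReal (lintegralV_lt_top hμ (ofReal_mul_mem_disc he hx0 hx)).ne,
    enorm_sq_eq_ofReal, Complex.norm_real, Real.norm_of_nonneg (testDensity_pos μ e hx).le,
    ← ENNReal.ofReal_mul (by positivity), ← ENNReal.ofReal_one,
    ← ENNReal.ofReal_add zero_le_one (by positivity), ← ENNReal.ofReal_mul (by positivity)]
  congr 1
  have add_eq : 1 + 1 / (1 - x) * (lintegralV μ (x * e)).toReal =
      radialWeight μ e x / (1 - x) ^ 2 := by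
    rw [radialWeight]
    field_simp
    ring
  rw [add_eq, testDensity]
  field_simp

variable [SFinite (μ.restrict disc)]

lemma measurable_testDensity : Measurable (testDensity μ e) := by
  have := measurable_radialWeight μ e
  unfold testDensity
  fun_prop

lemma integrableOn_testDensity_mul (hρ : ρ < 1) {g : ℝ → ℝ} (hg : ContinuousOn g (Icc 0 ρ)) :
    IntegrableOn (fun x => testDensity μ e x * g x) (Ioo 0 ρ) := by
  have h := (integrableOn_one_div_radialWeight μ e hρ).mono_set Ioo_subset_Ioc_self
  refine (h.mul_continuousOn_of_subset (g' := fun x => (1 - x) * g x) (by fun_prop)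
    measurableSet_Ioo isCompact_Icc Ioo_subset_Icc_self).congr_fun (fun x _ => ?_) measurableSet_Ioo
  simp only [testDensity]
  ring

lemma integrableOn_testDensity (hρ : ρ < 1) : IntegrableOn (testDensity μ e) (Ioo 0 ρ) := by
  simpa using integrableOn_testDensity_mul μ e hρ (g := fun _ => 1) continuousOn_const

lemma radialSize_lt_top (hρ : ρ < 1) : radialSize μ e ρ < ⊤ :=
  ((integrableOn_one_div_radialWeight μ e hρ).mono_set Ioo_subset_Ioc_self).lintegral_lt_top

lemma radialSize_le_enorm_radialSzego (he : ‖e‖ = 1) (hρ : ρ < 1) :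
    radialSize μ e ρ ≤ 2 * ‖radialSzego (fun x => testDensity μ e x) e ρ (ρ * e)‖ₑ := by
  have one_sub_mul_pos {x : ℝ} (hx : x ∈ Icc 0 ρ) : 0 < 1 - x * ρ := by nlinarith [hx.1, hx.2]
  have integrable : IntegrableOn (fun x => testDensity μ e x * (1 - x * ρ)⁻¹) (Ioo 0 ρ) :=
    integrableOn_testDensity_mul μ e hρ
      (ContinuousOn.inv₀ (by fun_prop) fun x hx => (one_sub_mul_pos hx).ne')
  have nonneg : 0 ≤ᵐ[volume.restrict (Ioo 0 ρ)] fun x => testDensity μ e x * (1 - x * ρ)⁻¹ := by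
    filter_upwards [ae_restrict_mem measurableSet_Ioo] with x hx
    exact mul_nonneg (testDensity_pos μ e (hx.2.trans hρ)).le
      (inv_nonneg.2 (one_sub_mul_pos (Ioo_subset_Icc_self hx)).le)
  have value : radialSzego (fun x => testDensity μ e x) e ρ (ρ * e) =
      ((∫ x in Ioo 0 ρ, testDensity μ e x * (1 - x * ρ)⁻¹ : ℝ) : ℂ) := by
    rw [radialSzego, szegoIntegral, ← integral_complex_ofReal]
    refine integral_congr_ae (ae_of_all _ fun x => ?_)
    simp only [conj_ofReal_mul_mul_ofReal_mul he]
    push_cast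
    ring
  rw [value, ← ofReal_norm, Complex.norm_real, Real.norm_of_nonneg (integral_nonneg_of_ae nonneg),
    ofReal_integral_eq_lintegral_ofReal integrable nonneg, radialSize,
    ← lintegral_const_mul' _ _ (by simp)]
  refine setLIntegral_mono' measurableSet_Ioo fun x hx => ?_
  rw [← ENNReal.ofReal_ofNat, ← ENNReal.ofReal_mul zero_le_two]
  refine ENNReal.ofReal_le_ofReal ?_
  have hψ := radialWeight_pos μ e (hx.2.trans hρ)
  have den_pos := one_sub_mul_pos (Ioo_subset_Icc_self hx)
  rw [testDensity, div_mul_eq_mul_div, ← mul_div_assoc]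
  gcongr
  rw [← mul_assoc, ← div_eq_mul_inv, one_le_div den_pos]
  nlinarith [hx.1, hx.2]

lemma dirichletNormSq_radialSzego_testDensity_le {ω : ℂ → ℝ≥0∞}
    (hω : IsPureSuperharmonicWeight ω μ) (he : ‖e‖ = 1) (hρ : ρ < 1) :
    dirichletNormSq ω (radialSzego (fun x => testDensity μ e x) e ρ) ≤ 16 * radialSize μ e ρ := by
  refine (dirichletNormSq_radialSzego_le hω
    (Complex.measurable_ofReal.comp (measurable_testDensity μ e))
    (integrableOn_testDensity μ e hρ).ofReal he hρ.le).trans_eq ?_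
  congr 1
  exact setLIntegral_congr_fun measurableSet_Ioo fun x hx =>
    testDensity_sq_mul_eq μ e hω.riesz_finite he hx.1.le (hx.2.trans hρ)

end TestFunction

lemma exists_memDirichlet_radialSize_le {ω : ℂ → ℝ≥0∞} {μ : Measure ℂ}
    (hω : IsPureSuperharmonicWeight ω μ) {z : ℂ} (hz : z ∈ disc) (hz0 : z ≠ 0) :
    ∃ f : ℂ → ℂ, MemDirichlet ω f ∧
      dirichletNormSq ω f ≤ 16 * radialSize μ (z / (‖z‖ : ℂ)) ‖z‖ ∧
      radialSize μ (z / (‖z‖ : ℂ)) ‖z‖ ≤ 2 * ‖f z‖ₑ := by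
  have := sFinite_restrict_disc hω.riesz_finite
  have he := norm_div_norm hz0
  have hρ := mem_disc.1 hz
  have norm_le := dirichletNormSq_radialSzego_testDensity_le μ _ hω he hρ
  have value_ge := radialSize_le_enorm_radialSzego μ _ he hρ
  rw [norm_mul_div_norm hz0] at value_ge
  exact ⟨_, memDirichlet_of_dirichletNormSq_lt_top
    (differentiableOn_radialSzego (integrableOn_testDensity μ _ hρ).ofReal he hρ.le)
    (norm_le.trans_lt (ENNReal.mul_lt_top (by simp) (radialSize_lt_top μ _ hρ))),
    norm_le, value_ge⟩

section CoeffSpace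

/-- The Hilbert space of square summable sequences of Taylor coefficients. -/
abbrev CoeffSpace : Type := lp (fun _ : ℕ => ℂ) 2

lemma memℓp_two_iff {ι : Type*} {E : ι → Type*} [∀ i, NormedAddCommGroup (E i)] {a : ∀ i, E i} :
    Memℓp a 2 ↔ Summable fun i => ‖a i‖ ^ 2 := by
  rw [memℓp_gen_iff (by simp)]
  simp

lemma memℓp_two_of_summable_norm {ι : Type*} {E : ι → Type*} [∀ i, NormedAddCommGroup (E i)]
    {a : ∀ i, E i} (h : Summable fun i => ‖a i‖) : Memℓp a 2 :=
  (memℓp_gen (by simpa using h) : Memℓp a 1).of_exponent_ge one_le_two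

/-- The vector of `ℓ²` that represents evaluation at `z`. -/
def evalVec {z : ℂ} (hz : z ∈ disc) : CoeffSpace :=
  ⟨fun n => conj (z ^ n), memℓp_two_of_summable_norm <| by
    simpa using summable_geometric_of_lt_one (norm_nonneg z) (mem_disc.1 hz)⟩

/-- The vector of `ℓ²` that represents evaluation of the derivative at `z`. -/
def derivVec {z : ℂ} (hz : z ∈ disc) : CoeffSpace :=
  ⟨fun n => conj ((n : ℂ) * z ^ (n - 1)), memℓp_two_of_summable_norm <|
    (summable_nat_add_iff 1).1 <| by
      simpa using (hasSum_succ_mul_geometric (mem_disc.1 hz)).summable.norm⟩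

/-- The holomorphic function on the disc with given Taylor coefficients. -/
def powerSeriesFun (a : CoeffSpace) (z : ℂ) : ℂ :=
  ∑' n, a n * z ^ n

variable {z : ℂ}

lemma hasSum_inner_evalVec (hz : z ∈ disc) (a : CoeffSpace) :
    HasSum (fun n => a n * z ^ n) (inner ℂ (evalVec hz) a) :=
  (lp.hasSum_inner (𝕜 := ℂ) (evalVec hz) a).congr_fun fun n => by simp [evalVec]

lemma hasSum_powerSeriesFun (a : CoeffSpace) :
    ∀ z ∈ disc, HasSum (fun n => a n * z ^ n) (powerSeriesFun a z) :=
  fun _ hz => (hasSum_inner_evalVec hz a).summable.hasSum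

lemma powerSeriesFun_eq_inner (hz : z ∈ disc) (a : CoeffSpace) :
    powerSeriesFun a z = inner ℂ (evalVec hz) a :=
  (hasSum_inner_evalVec hz a).tsum_eq

lemma deriv_powerSeriesFun (hz : z ∈ disc) (a : CoeffSpace) :
    deriv (powerSeriesFun a) z = inner ℂ (derivVec hz) a := by
  have h := lp.hasSum_inner (𝕜 := ℂ) (derivVec hz) a
  have zeroth : ∑ i ∈ Finset.range 1, inner ℂ (derivVec hz i) (a i) = 0 := by simp [derivVec]
  rw [← hasSum_nat_add_iff' 1, zeroth, sub_zero] at h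
  refine (hasSum_deriv_of_hasSum (hasSum_powerSeriesFun a) hz).unique (h.congr_fun fun n => ?_)
  simp only [derivVec, add_tsub_cancel_right, RCLike.inner_apply, Complex.conj_conj]
  push_cast
  ring

lemma taylorCoeff_powerSeriesFun (a : CoeffSpace) (n : ℕ) :
    taylorCoeff (powerSeriesFun a) n = a n :=
  taylorCoeff_eq_of_hasSum (hasSum_powerSeriesFun a) n

lemma memHardy_powerSeriesFun (a : CoeffSpace) : MemHardy (powerSeriesFun a) :=
  ⟨differentiableOn_of_hasSum (hasSum_powerSeriesFun a), by
    simpa only [taylorCoeff_powerSeriesFun] using memℓp_two_iff.1 (lp.memℓp a)⟩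

/-- The sequence of Taylor coefficients of a function of `H²`. -/
def coeffVec {f : ℂ → ℂ} (hf : MemHardy f) : CoeffSpace :=
  ⟨taylorCoeff f, memℓp_two_iff.2 hf.2⟩

lemma powerSeriesFun_coeffVec {f : ℂ → ℂ} (hf : MemHardy f) :
    EqOn (powerSeriesFun (coeffVec hf)) f disc :=
  fun _ hz => (hasSum_taylorCoeff hf.1 hz).tsum_eq

lemma coeffVec_powerSeriesFun (a : CoeffSpace) : coeffVec (memHardy_powerSeriesFun a) = a :=
  lp.ext <| funext <| taylorCoeff_powerSeriesFun a

lemma ofReal_norm_coeffVec_sq {f : ℂ → ℂ} (hf : MemHardy f) :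
    ENNReal.ofReal (‖coeffVec hf‖ ^ 2) = ∑' n, ‖taylorCoeff f n‖ₑ ^ 2 := by
  have norm_sq : ‖coeffVec hf‖ ^ 2 = ∑' n, ‖taylorCoeff f n‖ ^ 2 := by
    simpa [coeffVec] using lp.norm_rpow_eq_tsum (p := 2) (by simp) (coeffVec hf)
  rw [norm_sq, ENNReal.ofReal_tsum_of_nonneg (fun n => by positivity) hf.2]
  simp only [enorm_sq_eq_ofReal]

end CoeffSpace

section Embedding

/-- The Hilbert space `ℓ² ⊕ L²(ω dA)`, in which `D_ω` is embedded by
`f ↦ (Taylor coefficients of f, f')`. -/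
abbrev AmbientSpace (ω : ℂ → ℝ≥0∞) : Type :=
  WithLp 2 (CoeffSpace × Lp ℂ 2 (areaMeasure.withDensity ω))

variable {ω : ℂ → ℝ≥0∞} {f g : ℂ → ℂ}

lemma ae_withDensity_mem_disc (ω : ℂ → ℝ≥0∞) : ∀ᵐ z ∂areaMeasure.withDensity ω, z ∈ disc :=
  (withDensity_absolutelyContinuous _ _).ae_le ae_mem_disc

/-- The image of `D_ω` in the ambient Hilbert space. -/
def dirichletSubmodule (ω : ℂ → ℝ≥0∞) : Submodule ℂ (AmbientSpace ω) where
  carrier := {p | p.snd =ᵐ[areaMeasure.withDensity ω] deriv (powerSeriesFun p.fst)}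
  add_mem' {p q} hp hq := by
    filter_upwards [hp, hq, Lp.coeFn_add p.snd q.snd, ae_withDensity_mem_disc ω] with z hpz hqz h hz
    rw [WithLp.add_snd, h, Pi.add_apply, hpz, hqz, WithLp.add_fst]
    simp only [deriv_powerSeriesFun hz, inner_add_right]
  zero_mem' := by
    filter_upwards [Lp.coeFn_zero ℂ 2 (areaMeasure.withDensity ω), ae_withDensity_mem_disc ω]
      with z h hz
    rw [WithLp.zero_snd, h, WithLp.zero_fst, deriv_powerSeriesFun hz, inner_zero_right,
      Pi.zero_apply]
  smul_mem' c p hp := by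
    filter_upwards [hp, Lp.coeFn_smul c p.snd, ae_withDensity_mem_disc ω] with z hpz h hz
    rw [WithLp.smul_snd, h, Pi.smul_apply, hpz, WithLp.smul_fst]
    simp only [deriv_powerSeriesFun hz, inner_smul_right, smul_eq_mul]

lemma mem_dirichletSubmodule {p : AmbientSpace ω} : p ∈ dirichletSubmodule ω ↔
    p.snd =ᵐ[areaMeasure.withDensity ω] deriv (powerSeriesFun p.fst) :=
  Iff.rfl

lemma isClosed_dirichletSubmodule (ω : ℂ → ℝ≥0∞) :
    IsClosed (dirichletSubmodule ω : Set (AmbientSpace ω)) := by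
  refine IsSeqClosed.isClosed fun p q hp hpq => ?_
  have tendsto_fst := ((WithLp.fstL 2 ℂ _ _).continuous.tendsto q).comp hpq
  have tendsto_snd := ((WithLp.sndL 2 ℂ _ _).continuous.tendsto q).comp hpq
  obtain ⟨ns, hns, hae⟩ := (tendstoInMeasure_of_tendsto_Lp tendsto_snd).exists_seq_tendsto_ae
  filter_upwards [hae, ae_all_iff.2 hp, ae_withDensity_mem_disc ω] with z hz_lim hz_eq hz
  refine tendsto_nhds_unique hz_lim ?_
  have continuous_inner : Continuous fun a : CoeffSpace => inner ℂ (derivVec hz) a := by fun_prop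
  have h := ((continuous_inner.tendsto _).comp tendsto_fst).comp hns.tendsto_atTop
  rw [deriv_powerSeriesFun hz]
  refine h.congr fun k => ?_
  exact ((hz_eq (ns k)).trans (deriv_powerSeriesFun hz _)).symm

lemma lintegral_withDensity_eq_dirichletIntegral (hω : AEMeasurable ω areaMeasure)
    (hf : DifferentiableOn ℂ f disc) :
    ∫⁻ z, ‖deriv f z‖ₑ ^ 2 ∂areaMeasure.withDensity ω = dirichletIntegral ω f := by
  rw [lintegral_withDensity_eq_lintegral_mul₀ hω ((aestronglyMeasurable_areaMeasure
    (differentiableOn_deriv hf).continuousOn).enorm.pow_const 2), dirichletIntegral]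
  simp only [Pi.mul_apply, mul_comm]

lemma memLp_deriv_iff (hω : AEMeasurable ω areaMeasure) (hf : DifferentiableOn ℂ f disc) :
    MemLp (deriv f) 2 (areaMeasure.withDensity ω) ↔ dirichletIntegral ω f < ⊤ := by
  have meas : AEStronglyMeasurable (deriv f) (areaMeasure.withDensity ω) :=
    (aestronglyMeasurable_areaMeasure (differentiableOn_deriv hf).continuousOn).mono_ac
      (withDensity_absolutelyContinuous _ _)
  rw [← lintegral_withDensity_eq_dirichletIntegral hω hf, ← eLpNorm_two_sq, MemLp,
    and_iff_right meas, ENNReal.pow_lt_top_iff]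
  simp

variable (hω : AEMeasurable ω areaMeasure)

include hω in
lemma MemDirichlet.memLp_deriv (hf : MemDirichlet ω f) :
    MemLp (deriv f) 2 (areaMeasure.withDensity ω) :=
  (memLp_deriv_iff hω hf.1.1).2 hf.2

/-- The isometric embedding of `D_ω` in the ambient Hilbert space. -/
def embed (hf : MemDirichlet ω f) : AmbientSpace ω :=
  WithLp.toLp 2 (coeffVec hf.1, (hf.memLp_deriv hω).toLp)

lemma embed_mem (hf : MemDirichlet ω f) : embed hω hf ∈ dirichletSubmodule ω := by
  filter_upwards [ae_withDensity_mem_disc ω, (hf.memLp_deriv hω).coeFn_toLp] with z hz h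
  exact h.trans (((powerSeriesFun_coeffVec hf.1).deriv isOpen_disc hz).symm)

lemma exists_embed_eq {p : AmbientSpace ω} (hp : p ∈ dirichletSubmodule ω) :
    ∃ h : MemDirichlet ω (powerSeriesFun p.fst), embed hω h = p := by
  have hardy := memHardy_powerSeriesFun p.fst
  have ae_eq := mem_dirichletSubmodule.1 hp
  have memLp := (memLp_congr_ae ae_eq).1 (Lp.memLp p.snd)
  refine ⟨⟨hardy, (memLp_deriv_iff hω hardy.1).1 memLp⟩, ?_⟩
  have snd_eq : memLp.toLp = p.snd := Lp.ext (memLp.coeFn_toLp.trans ae_eq.symm)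
  exact congrArg (WithLp.toLp 2) (Prod.ext (coeffVec_powerSeriesFun p.fst) snd_eq)

lemma ofReal_norm_embed_sq (hf : MemDirichlet ω f) :
    ENNReal.ofReal (‖embed hω hf‖ ^ 2) = dirichletNormSq ω f := by
  have norm_snd : ENNReal.ofReal (‖(embed hω hf).snd‖ ^ 2) = dirichletIntegral ω f := by
    rw [← lintegral_withDensity_eq_dirichletIntegral hω hf.1.1, ← eLpNorm_two_sq,
      ← enorm_sq_eq_ofReal]
    exact congrArg (· ^ 2) (Lp.enorm_toLp (hf.memLp_deriv hω))
  rw [WithLp.prod_norm_sq_eq_of_L2, ENNReal.ofReal_add (by positivity) (by positivity), norm_snd,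
    dirichletNormSq, ← ofReal_norm_coeffVec_sq hf.1]
  rfl

lemma inner_embed (hfin : ∀ᵐ z ∂areaMeasure, ω z < ⊤) (hf : MemDirichlet ω f)
    (hg : MemDirichlet ω g) :
    inner ℂ (embed hω hg) (embed hω hf) = dirichletInner ω f g := by
  have hardy : inner ℂ (coeffVec hg.1) (coeffVec hf.1) = hardyInner f g := lp.inner_eq_tsum _ _
  have weighted : inner ℂ (hg.memLp_deriv hω).toLp (hf.memLp_deriv hω).toLp =
      ∫ z, deriv f z * conj (deriv g z) * ((ω z).toReal : ℂ) ∂areaMeasure := by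
    calc _ = ∫ z, deriv f z * conj (deriv g z) ∂areaMeasure.withDensity ω := by
          rw [L2.inner_def]
          refine integral_congr_ae ?_
          filter_upwards [(hf.memLp_deriv hω).coeFn_toLp, (hg.memLp_deriv hω).coeFn_toLp]
            with z hfz hgz
          rw [hfz, hgz, RCLike.inner_apply]
      _ = _ := by
          rw [integral_withDensity_eq_integral_toReal_smul₀ hω hfin]
          simp only [Complex.real_smul, mul_comm]
  exact congrArg₂ (· + ·) hardy weighted

end Embedding

section ReproducingKernel

variable {ω : ℂ → ℝ≥0∞} (hω : AEMeasurable ω areaMeasure) (hfin : ∀ᵐ z ∂areaMeasure, ω z < ⊤)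
include hω

lemma dirichletNormSq_lt_top {f : ℂ → ℂ} (hf : MemDirichlet ω f) : dirichletNormSq ω f < ⊤ := by
  rw [← ofReal_norm_embed_sq hω hf]
  exact ENNReal.ofReal_lt_top

include hfin

lemma dirichletInner_self {f : ℂ → ℂ} (hf : MemDirichlet ω f) :
    dirichletInner ω f f = ((dirichletNormSq ω f).toReal : ℂ) := by
  rw [← inner_embed hω hfin hf hf, ← ofReal_norm_embed_sq hω hf,
    ENNReal.toReal_ofReal (by positivity), inner_self_eq_norm_sq_to_K]
  simp

lemma enorm_dirichletInner_sq_le {f g : ℂ → ℂ} (hf : MemDirichlet ω f) (hg : MemDirichlet ω g) :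
    ‖dirichletInner ω f g‖ₑ ^ 2 ≤ dirichletNormSq ω f * dirichletNormSq ω g := by
  rw [← inner_embed hω hfin hf hg, ← ofReal_norm_embed_sq hω hf, ← ofReal_norm_embed_sq hω hg,
    enorm_sq_eq_ofReal, ← ENNReal.ofReal_mul (by positivity), ← mul_pow, mul_comm ‖embed hω hf‖]
  gcongr
  exact norm_inner_le_norm _ _

lemma exists_isReproducingKernel : ∃ K : ℂ → ℂ → ℂ, IsReproducingKernel ω K := by
  have := (isClosed_dirichletSubmodule ω).completeSpace_coe
  suffices h : ∀ z ∈ disc, ∃ k : ℂ → ℂ, MemDirichlet ω k ∧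
      ∀ f, MemDirichlet ω f → f z = dirichletInner ω f k by
    choose! k hk using h
    exact ⟨fun ζ z => k z ζ, hk⟩
  intro z hz
  set v : AmbientSpace ω := WithLp.toLp 2 (evalVec hz, 0)
  obtain ⟨hk, embed_eq⟩ :=
    exists_embed_eq hω ((dirichletSubmodule ω).starProjection_apply_mem v)
  refine ⟨_, hk, fun f hf => ?_⟩
  have orthogonal := (dirichletSubmodule ω).starProjection_inner_eq_zero v _ (embed_mem hω hf)
  rw [inner_sub_left, sub_eq_zero] at orthogonal
  rw [← inner_embed hω hfin hf hk, embed_eq, ← orthogonal, WithLp.prod_inner_apply,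
    ← powerSeriesFun_coeffVec hf.1 hz, powerSeriesFun_eq_inner hz, inner_zero_left, add_zero]
  rfl

variable {K : ℂ → ℂ → ℂ} (hK : IsReproducingKernel ω K) {z : ℂ} (hz : z ∈ disc)
include hK hz

lemma kernel_diag_eq : K z z = ((dirichletNormSq ω fun ζ => K ζ z).toReal : ℂ) :=
  ((hK z hz).2 _ (hK z hz).1).trans (dirichletInner_self hω hfin (hK z hz).1)

lemma enorm_sq_le_kernel_mul {f : ℂ → ℂ} (hf : MemDirichlet ω f) :
    ‖f z‖ₑ ^ 2 ≤ (dirichletNormSq ω fun ζ => K ζ z) * dirichletNormSq ω f := by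
  rw [(hK z hz).2 f hf, mul_comm]
  exact enorm_dirichletInner_sq_le hω hfin hf (hK z hz).1

lemma one_le_dirichletNormSq_kernel : 1 ≤ dirichletNormSq ω fun ζ => K ζ z := by
  have norm_one : dirichletNormSq ω (fun _ => 1) = 1 := by
    rw [dirichletNormSq, dirichletIntegral, tsum_eq_single 0
      (fun n hn => by simp [taylorCoeff, iteratedDeriv_const, hn])]
    simp [taylorCoeff]
  have mem_one : MemDirichlet ω (fun _ => 1) :=
    memDirichlet_of_dirichletNormSq_lt_top (differentiableOn_const _) (by simp [norm_one])
  simpa [norm_one] using enorm_sq_le_kernel_mul hω hfin hK hz mem_one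

end ReproducingKernel

lemma le_of_sq_le_mul {a b : ℝ≥0∞} (ha : a ≠ ⊤) (h : a ^ 2 ≤ b * a) : a ≤ b := by
  rcases eq_or_ne a 0 with rfl | ha0
  · exact zero_le
  · rwa [sq, ENNReal.mul_le_mul_iff_left ha0 ha] at h

section Estimates

variable {ω : ℂ → ℝ≥0∞} {μ : Measure ℂ} {K : ℂ → ℂ → ℂ} {z : ℂ}
  (hω : IsPureSuperharmonicWeight ω μ) (hK : IsReproducingKernel ω K) (hz : z ∈ disc) (hz0 : z ≠ 0)
include hω hK hz hz0

lemma dirichletNormSq_kernel_le :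
    dirichletNormSq ω (fun ζ => K ζ z) ≤ 288 * ENNReal.ofReal (kernelSize μ z) := by
  have finite := dirichletNormSq_lt_top (aemeasurable_weight hω) (hK z hz).1
  refine le_of_sq_le_mul finite.ne ?_
  have diag := kernel_diag_eq (aemeasurable_weight hω) (ae_weight_lt_top hω) hK hz
  calc (dirichletNormSq ω fun ζ => K ζ z) ^ 2 = ‖K z z‖ₑ ^ 2 := by
        rw [diag, ← ofReal_norm, Complex.norm_real, Real.norm_of_nonneg ENNReal.toReal_nonneg,
          ENNReal.ofReal_toReal finite.ne]
    _ ≤ _ := enorm_sq_le_kernelSize_mul hω (hK z hz).1.1.1 hz hz0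

lemma ofReal_kernelSize_le :
    ENNReal.ofReal (kernelSize μ z) ≤ 65 * dirichletNormSq ω fun ζ => K ζ z := by
  have := sFinite_restrict_disc hω.riesz_finite
  have hm := aemeasurable_weight hω
  have hfin := ae_weight_lt_top hω
  obtain ⟨f, hf, norm_le, le_value⟩ := exists_memDirichlet_radialSize_le hω hz hz0
  rw [ofReal_kernelSize μ hz hz0]
  set N := dirichletNormSq ω fun ζ => K ζ z
  set S := radialSize μ (z / (‖z‖ : ℂ)) ‖z‖
  have radialSize_le : S ≤ 64 * N := by
    refine le_of_sq_le_mul (radialSize_lt_top μ _ (mem_disc.1 hz)).ne ?_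
    calc S ^ 2 ≤ (2 * ‖f z‖ₑ) ^ 2 := by gcongr
      _ = 4 * ‖f z‖ₑ ^ 2 := by ring
      _ ≤ 4 * (N * (16 * S)) := by
          gcongr
          exact (enorm_sq_le_kernel_mul hm hfin hK hz hf).trans (by gcongr)
      _ = 64 * N * S := by ring
  calc 1 + S ≤ N + 64 * N :=
        add_le_add (one_le_dirichletNormSq_kernel hm hfin hK hz) radialSize_le
    _ = 65 * N := by ring

lemma re_kernel_le : (K z z).re ≤ 288 * kernelSize μ z := by
  have := sFinite_restrict_disc hω.riesz_finite
  have kernelSize_pos : 0 < kernelSize μ z := by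
    rw [← ENNReal.ofReal_pos, ofReal_kernelSize μ hz hz0]
    simp
  rw [kernel_diag_eq (aemeasurable_weight hω) (ae_weight_lt_top hω) hK hz, Complex.ofReal_re]
  refine ENNReal.toReal_le_of_le_ofReal (by positivity) ?_
  rw [ENNReal.ofReal_mul (by norm_num), ENNReal.ofReal_ofNat]
  exact dirichletNormSq_kernel_le hω hK hz hz0

lemma kernelSize_le_re_kernel : kernelSize μ z ≤ 65 * (K z z).re := by
  have finite := dirichletNormSq_lt_top (aemeasurable_weight hω) (hK z hz).1
  rw [kernel_diag_eq (aemeasurable_weight hω) (ae_weight_lt_top hω) hK hz, Complex.ofReal_re]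
  simpa using (ENNReal.ofReal_le_iff_le_toReal (ENNReal.mul_lt_top (by simp) finite).ne).1
    (ofReal_kernelSize_le hω hK hz hz0)

end Estimates

end

end SuperharmonicDirichlet

theorem theorem3p1 :
    ∃ c C : ℝ, 0 < c ∧ 0 < C ∧
      ∀ (ω : ℂ → ENNReal) (μ : MeasureTheory.Measure ℂ),
        SuperharmonicDirichlet.IsPureSuperharmonicWeight ω μ →
        (∃ K : ℂ → ℂ → ℂ, SuperharmonicDirichlet.IsReproducingKernel ω K) ∧
        ∀ K : ℂ → ℂ → ℂ, SuperharmonicDirichlet.IsReproducingKernel ω K →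
          ∀ z ∈ SuperharmonicDirichlet.disc, z ≠ 0 →
            (K z z).im = 0 ∧
            c * SuperharmonicDirichlet.kernelSize μ z ≤ (K z z).re ∧
            (K z z).re ≤ C * SuperharmonicDirichlet.kernelSize μ z := by
  refine ⟨1 / 65, 288, by norm_num, by norm_num, fun ω μ hω => ?_⟩
  have meas := SuperharmonicDirichlet.aemeasurable_weight hω
  have finite := SuperharmonicDirichlet.ae_weight_lt_top hω
  refine ⟨SuperharmonicDirichlet.exists_isReproducingKernel meas finite,
    fun K hK z hz hz0 => ⟨?_, ?_, SuperharmonicDirichlet.re_kernel_le hω hK hz hz0⟩⟩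
  · rw [SuperharmonicDirichlet.kernel_diag_eq meas finite hK hz, Complex.ofReal_im]
  · linarith [SuperharmonicDirichlet.kernelSize_le_re_kernel hω hK hz hz0]
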